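/- Let $k$ be an algebraically closed field, $t\ge 2$, and $U=k[x_0,\dots,x_t]$ with its usual grading. Let $\phi$ be a graded $k$-algebra automorphism of $U$, let $\varphi$ be the corresponding automorphism of $\mathbb{P}^t$, so that $\mathfrak{m}_{\varphi(d)}=\phi^{-1}(\mathfrak{m}_d)$, where $\mathfrak{m}_d\subseteq U$ is the homogeneous ideal of a (closed) point $d$. Let $S$ be the Zhang twist of $U$: the same graded vector space, with product $fh=\phi^n(f)\circ h$ for $h\in U_n$, where $\circ$ is the product of $U$. For a homogeneous ideal $I$ of $U$, the same subspace is a graded left ideal of $S$. Put $P(d)=S/\mathfrak{m}_d$. Let $c\in\mathbb{P}^t$, $c_i=\varphi^{-i}(c)$ for $i\in\mathbb{Z}$, and let $R\subseteq S$ be the subalgebra generated by the linear forms in $S_1=U_1$ that vanish at $c$, with the grading $R_n=R\cap S_n$. A point module over $R$ is a $\mathbb{Z}$-graded left $R$-module $M$ that is cyclic, generated in degree $0$, with $\dim_k M_n=1$ for all $n\ge 0$; its point ideal is the left ideal $\operatorname{ann}_R(M_0)$, so that $M\cong R/\operatorname{ann}_R(M_0)$. Isomorphisms of graded modules preserve degrees;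 $M_{\ge n}=\bigoplus_{j\ge n}M_j$, and $M_{\le n}=M/M_{\ge n+1}$. The square $\mathfrak{m}_d^2$ is taken in $U$. Assume the critical density condition: the set $\{c_i\}_{i\in\mathbb{Z}}$ is infinite, and every proper Zariski-closed subset of $\mathbb{P}^t$ contains only finitely many of its points. Then: (1) For every $d\in\mathbb{P}^t\setminus\{c_i\}_{i\ge 0}$, the module $P(d)$, regarded as an $R$-module, is an $R$-point module with point ideal $R\cap\mathfrak{m}_d$. (2) For every $i\ge 0$, the $R$-module $P(c_i)_{\ge i+1}$ becomes an $R$-point module after its degrees are shifted down by $i+1$. There is a family $\{P(c_i,e)\mid e\in\mathbb{P}^{t-1}\}$ of pairwise non-isomorphic $R$-point modules such that, for every $e$, $P(c_i,e)_{\ge i+1}\cong P(c_i)_{\ge i+1}$ and $P(c_i,e)_{\le i}\cong P(c_i)_{\le i}$ as graded $R$-modules. The parameter $e$ is natural: there is a surjective linear map $\lambda: R_{i+1}\to k^t$ with kernel $(R\cap\mathfrak{m}_{c_i}^2)_{i+1}$ such that, for every $e=(e_1:\dots:e_t)$, the degree $i+1$ part of the point ideal of $P(c_i,e)$ is $\{f\in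 R_{i+1}\mid \sum_j e_j\lambda_j(f)=0\}$. An $R$-point module is isomorphic to $P(c_i,e)$ for some $e\in\mathbb{P}^{t-1}$ if and only if its point ideal contains $R\cap\mathfrak{m}_{c_i}^2$. (3) The point modules $P(d)$ ($d\notin\{c_i\}_{i\ge0}$) and $P(c_i,e)$ ($i\ge 0$, $e\in\mathbb{P}^{t-1}$) are pairwise non-isomorphic, and every $R$-point module is isomorphic to one of them. -/

import Mathlib

universe u v v' w

namespace PointModules

open MvPolynomial

/-! ### Graded modules -/

section Internal

variable {k M ι : Type*} [Field k] [AddCommGroup M] [Module k M] [DecidableEq ι]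

theorem isInternal_sub (deg : ι → Submodule k M) (h : iSupIndep deg)
    (N : Submodule k M) (hN : N ≤ ⨆ n, N ⊓ deg n) :
    DirectSum.IsInternal (fun n => (deg n).comap N.subtype) := by
  rw [DirectSum.isInternal_submodule_iff_iSupIndep_and_iSup_eq_top]
  constructor
  · intro n
    rw [Submodule.disjoint_def]
    intro x hx hx'
    have h1 : (x : M) ∈ ⨆ (j) (_ : j ≠ n), deg j := by
      have h2 : (⨆ (j) (_ : j ≠ n), (deg j).comap N.subtype) ≤
          (⨆ (j) (_ : j ≠ n), deg j).comap N.subtype :=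
        iSup₂_le fun j hj => Submodule.comap_mono (le_iSup₂_of_le j hj le_rfl)
      exact h2 hx'
    exact Subtype.ext ((Submodule.disjoint_def.1 (h n)) _ hx h1)
  · rw [eq_top_iff]
    rintro ⟨x, hx⟩ -
    have h1 : x ∈ (⨆ n, (deg n).comap N.subtype).map N.subtype := by
      rw [Submodule.map_iSup]
      refine (hN.trans (iSup_mono fun n => ?_)) hx
      rintro y ⟨hy, hy'⟩
      exact ⟨⟨y, hy⟩, hy', rfl⟩
    obtain ⟨y, hy, hyx⟩ := h1
    have : y = ⟨x, hx⟩ := Subtype.ext hyx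
    exact this ▸ hy

theorem isInternal_quot (deg : ι → Submodule k M) (h : DirectSum.IsInternal deg)
    (N : Submodule k M) (hN : N ≤ ⨆ n, N ⊓ deg n) :
    DirectSum.IsInternal (fun n => (deg n).map N.mkQ) := by
  rw [DirectSum.isInternal_submodule_iff_iSupIndep_and_iSup_eq_top] at h ⊢
  obtain ⟨hind, htop⟩ := h
  constructor
  · intro n
    rw [Submodule.disjoint_def]
    intro x hx hx'
    obtain ⟨a, ha, rfl⟩ := hx
    have h1 : N.mkQ a ∈ (⨆ (j) (_ : j ≠ n), deg j).map N.mkQ := by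
      simpa only [Submodule.map_iSup] using hx'
    obtain ⟨b, hb, hab⟩ := h1
    have hN1 : a - b ∈ N := by
      rw [← Submodule.ker_mkQ N, LinearMap.mem_ker, map_sub, hab, sub_self]
    have hN2 := hN hN1
    rw [iSup_split_single _ n, Submodule.mem_sup] at hN2
    obtain ⟨c, hc, d, hd, hcd⟩ := hN2
    have hd' : d ∈ ⨆ (j) (_ : j ≠ n), deg j :=
      (iSup₂_mono fun j _ => (inf_le_right : N ⊓ deg j ≤ deg j)) hd
    have hz : a - c = 0 := by
      refine (Submodule.disjoint_def.1 (hind n)) _ (Submodule.sub_mem _ ha hc.2) ?_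
      have : a - c = b + d := by
        rw [sub_eq_iff_eq_add, add_assoc, add_comm d c, hcd]; abel
      rw [this]
      exact Submodule.add_mem _ hb hd'
    have hac : a = c := sub_eq_zero.1 hz
    rw [← LinearMap.mem_ker, Submodule.ker_mkQ, hac]
    exact hc.1
  · rw [← Submodule.map_iSup, htop, Submodule.map_top, Submodule.range_mkQ]

end Internal

/-- A `ℤ`-graded left module over a `k`-algebra `A` that is `ℕ`-graded by `𝒜`. -/
structure GrMod {k : Type u} {A : Type w} [Field k] [Ring A] [Algebra k A]
    (𝒜 : ℕ → Submodule k A) where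
  carrier : Type v
  [addCommGroup : AddCommGroup carrier]
  [moduleBase : Module k carrier]
  [module : Module A carrier]
  [isScalarTower : IsScalarTower k A carrier]
  deg : ℤ → Submodule k carrier
  isInternal : DirectSum.IsInternal deg
  smul_mem : ∀ {m : ℕ} {n : ℤ} {a : A} {x : carrier},
    a ∈ 𝒜 m → x ∈ deg n → a • x ∈ deg (n + m)

attribute [instance] GrMod.addCommGroup GrMod.moduleBase GrMod.module GrMod.isScalarTower

namespace GrMod

section General

variable {k : Type u} {A : Type w} [Field k] [Ring A] [Algebra k A] {𝒜 : ℕ → Submodule k A}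

/-- Isomorphism of graded modules: an `A`-linear bijection that preserves degrees. -/
def Isom (M : GrMod.{u, v, w} 𝒜) (N : GrMod.{u, v', w} 𝒜) : Prop :=
  ∃ f : M.carrier ≃ₗ[A] N.carrier, ∀ (n : ℤ) (x : M.carrier), x ∈ M.deg n ↔ f x ∈ N.deg n

/-- The shift `M[n]`, with `M[n]_j = M_{n+j}`. -/
def shift (M : GrMod.{u, v, w} 𝒜) (n : ℤ) : GrMod.{u, v, w} 𝒜 where
  carrier := M.carrier
  deg j := M.deg (n + j)
  isInternal := by
    have h := M.isInternal
    rw [DirectSum.isInternal_submodule_iff_iSupIndep_and_iSup_eq_top] at h ⊢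
    refine ⟨h.1.comp (add_right_injective n), ?_⟩
    rw [← h.2]
    exact (Equiv.addLeft n).iSup_comp (g := M.deg)
  smul_mem {m j a x} ha hx := by
    rw [← add_assoc]
    exact M.smul_mem ha hx

/-- A graded submodule, as a graded module: `N_n = N ∩ M_n`. -/
def sub (M : GrMod.{u, v, w} 𝒜) (N : Submodule A M.carrier)
    (hN : N.restrictScalars k ≤ ⨆ n, N.restrictScalars k ⊓ M.deg n) : GrMod.{u, v, w} 𝒜 where
  carrier := N
  isScalarTower := ⟨fun r a x => Subtype.ext (smul_assoc r a (x : M.carrier))⟩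
  deg n := (M.deg n).comap (N.restrictScalars k).subtype
  isInternal := isInternal_sub M.deg
    (DirectSum.isInternal_submodule_iff_iSupIndep_and_iSup_eq_top _ |>.1 M.isInternal).1
    (N.restrictScalars k) hN
  smul_mem ha hx := M.smul_mem ha hx

/-- The quotient by a graded submodule: `(M / N)_n` is the image of `M_n`. -/
def quot (M : GrMod.{u, v, w} 𝒜) (N : Submodule A M.carrier)
    (hN : N.restrictScalars k ≤ ⨆ n, N.restrictScalars k ⊓ M.deg n) : GrMod.{u, v, w} 𝒜 where
  carrier := M.carrier ⧸ N
  deg n := (M.deg n).map (N.mkQ.restrictScalars k)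
  isInternal := isInternal_quot M.deg M.isInternal (N.restrictScalars k) hN
  smul_mem := by
    rintro m n a _ ha ⟨x, hx, rfl⟩
    exact ⟨a • x, M.smul_mem ha hx, map_smul N.mkQ a x⟩

/-- `M_{≥ n}` as a submodule. -/
def tailSub [GradedAlgebra 𝒜] (M : GrMod.{u, v, w} 𝒜) (n : ℤ) : Submodule A M.carrier where
  toAddSubmonoid := (⨆ (j : ℤ) (_ : n ≤ j), M.deg j).toAddSubmonoid
  smul_mem' := by
    intro a x hx
    change x ∈ (⨆ (j : ℤ) (_ : n ≤ j), M.deg j) at hx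
    change a • x ∈ (⨆ (j : ℤ) (_ : n ≤ j), M.deg j)
    have ha : a ∈ ⨆ m, 𝒜 m := by
      rw [(DirectSum.Decomposition.isInternal 𝒜).submodule_iSup_eq_top]
      trivial
    induction ha using Submodule.iSup_induction' with
    | zero => rw [zero_smul]; exact Submodule.zero_mem _
    | add b c _ _ hb hc => rw [add_smul]; exact Submodule.add_mem _ hb hc
    | mem m b hb =>
      rw [iSup_subtype'] at hx
      induction hx using Submodule.iSup_induction' with
      | zero => rw [smul_zero]; exact Submodule.zero_mem _
      | add y z _ _ hy hz => rw [smul_add]; exact Submodule.add_mem _ hy hz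
      | mem j y hy =>
        exact Submodule.mem_iSup_of_mem (j.1 + m)
          (Submodule.mem_iSup_of_mem (by have := j.2; omega) (M.smul_mem hb hy))

theorem tailSub_graded [GradedAlgebra 𝒜] (M : GrMod.{u, v, w} 𝒜) (n : ℤ) :
    (M.tailSub n).restrictScalars k ≤ ⨆ j, (M.tailSub n).restrictScalars k ⊓ M.deg j := by
  have h : ∀ j, n ≤ j → M.deg j ≤ (M.tailSub n).restrictScalars k := fun j hj =>
    le_iSup₂_of_le (f := fun (j : ℤ) (_ : n ≤ j) => M.deg j) j hj le_rfl
  exact iSup₂_le fun j hj => le_iSup_of_le j (le_inf (h j hj) le_rfl)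

/-- The tail `M_{≥ n} = ⨁_{j ≥ n} M_j`. -/
def tail [GradedAlgebra 𝒜] (M : GrMod.{u, v, w} 𝒜) (n : ℤ) : GrMod.{u, v, w} 𝒜 :=
  M.sub (M.tailSub n) (M.tailSub_graded n)

/-- The truncation `M_{≤ n} = M / M_{≥ n+1}`. -/
def trunc [GradedAlgebra 𝒜] (M : GrMod.{u, v, w} 𝒜) (n : ℤ) : GrMod.{u, v, w} 𝒜 :=
  M.quot (M.tailSub (n + 1)) (M.tailSub_graded (n + 1))

/-- The grading `B_n = B ∩ A_n` on a subalgebra `B ⊆ A`. -/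
def subalgDeg (𝒜 : ℕ → Submodule k A) (B : Subalgebra k A) (n : ℕ) : Submodule k B :=
  (𝒜 n).comap B.val.toLinearMap

/-- Restriction of scalars to a subalgebra `B ⊆ A`. -/
def restrict (M : GrMod.{u, v, w} 𝒜) (B : Subalgebra k A) :
    GrMod.{u, v, w} (subalgDeg 𝒜 B) where
  carrier := M.carrier
  deg := M.deg
  isInternal := M.isInternal
  smul_mem ha hx := M.smul_mem ha hx

/-- `M` is a point module: it is cyclic, generated in degree `0`, and `dim_k M_n = 1` for all
`n ≥ 0`. -/
def IsPointModule (M : GrMod.{u, v, w} 𝒜) : Prop :=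
  (∃ x ∈ M.deg 0, Submodule.span A {x} = ⊤) ∧
    ∀ n : ℕ, Module.finrank k (M.deg (n : ℤ)) = 1

/-- The left ideal `ann_A (M_0)`. If `M` is a point module it is the point ideal of `M`, that is
the unique graded left ideal `I` with `M ≅ A / I`. -/
def pointIdeal (M : GrMod.{u, v, w} 𝒜) : Ideal A where
  carrier := {a | ∀ x ∈ M.deg 0, a • x = 0}
  add_mem' {a b} ha hb x hx := by rw [add_smul, ha x hx, hb x hx, add_zero]
  zero_mem' x _ := zero_smul A x
  smul_mem' a b hb x hx := by rw [smul_eq_mul, mul_smul, hb x hx, smul_zero]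

/-- An `ℕ`-indexed family, extended by zero to negative degrees. -/
def extendDeg (𝒜 : ℕ → Submodule k A) : ℤ → Submodule k A
  | Int.ofNat n => 𝒜 n
  | Int.negSucc _ => ⊥

/-- The graded algebra `A` as a graded left module over itself. -/
def regular (𝒜 : ℕ → Submodule k A) [GradedAlgebra 𝒜] : GrMod.{u, w, w} 𝒜 where
  carrier := A
  deg := extendDeg 𝒜
  isInternal := by
    have h := DirectSum.Decomposition.isInternal 𝒜
    rw [DirectSum.isInternal_submodule_iff_iSupIndep_and_iSup_eq_top] at h ⊢
    constructor
    · rintro (n | n)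
      · refine (h.1 n).mono_right (iSup₂_le ?_)
        rintro (j | j) hj
        · exact le_iSup₂_of_le (f := fun (j : ℕ) (_ : j ≠ n) => 𝒜 j) j
            (fun e => hj (by rw [e])) le_rfl
        · exact bot_le
      · exact disjoint_bot_left
    · rw [eq_top_iff, ← h.2]
      exact iSup_le fun n => le_iSup (extendDeg 𝒜) (Int.ofNat n)
  smul_mem := by
    rintro m (n | n) a x ha hx
    · have : a * x ∈ 𝒜 (m + n) := SetLike.mul_mem_graded ha hx
      rw [add_comm] at this
      exact this
    · have hx0 : x = 0 := hx
      rw [hx0, smul_zero]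
      exact Submodule.zero_mem _

end General

end GrMod

theorem adjoin_le_iSup_inf {k : Type u} {A : Type w} [Field k] [Ring A] [Algebra k A]
    (𝒜 : ℕ → Submodule k A) [GradedAlgebra 𝒜] (V : Set A) (hV : ∀ x ∈ V, x ∈ 𝒜 1) :
    Subalgebra.toSubmodule (Algebra.adjoin k V) ≤
      ⨆ n, Subalgebra.toSubmodule (Algebra.adjoin k V) ⊓ 𝒜 n := by
  intro x hx
  change x ∈ Algebra.adjoin k V at hx
  induction hx using Algebra.adjoin_induction with
  | mem x h => exact Submodule.mem_iSup_of_mem 1 ⟨Algebra.subset_adjoin h, hV x h⟩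
  | algebraMap r =>
    exact Submodule.mem_iSup_of_mem 0
      ⟨Subalgebra.algebraMap_mem _ r, SetLike.algebraMap_mem_graded 𝒜 r⟩
  | add x y hx hy ihx ihy => exact Submodule.add_mem _ ihx ihy
  | mul x y hx hy ihx ihy =>
    suffices key : (⨆ n, Subalgebra.toSubmodule (Algebra.adjoin k V) ⊓ 𝒜 n) *
        (⨆ n, Subalgebra.toSubmodule (Algebra.adjoin k V) ⊓ 𝒜 n) ≤
        ⨆ n, Subalgebra.toSubmodule (Algebra.adjoin k V) ⊓ 𝒜 n from
      key (Submodule.mul_mem_mul ihx ihy)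
    rw [Submodule.iSup_mul]
    refine iSup_le fun m => ?_
    rw [Submodule.mul_iSup]
    refine iSup_le fun n => Submodule.mul_le.2 fun a ha b hb => ?_
    exact Submodule.mem_iSup_of_mem (m + n)
      ⟨Subalgebra.mul_mem _ ha.1 hb.1, SetLike.mul_mem_graded ha.2 hb.2⟩

/-- A subalgebra generated by homogeneous elements of degree `1` is graded. -/
@[reducible] noncomputable def gradedAlgebraAdjoin {k : Type u} {A : Type w} [Field k] [Ring A]
    [Algebra k A] (𝒜 : ℕ → Submodule k A) [GradedAlgebra 𝒜] (V : Set A) (hV : ∀ x ∈ V, x ∈ 𝒜 1) :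
    GradedAlgebra (GrMod.subalgDeg 𝒜 (Algebra.adjoin k V)) :=
  letI : DirectSum.Decomposition (GrMod.subalgDeg 𝒜 (Algebra.adjoin k V)) :=
    DirectSum.IsInternal.chooseDecomposition _
      (isInternal_sub 𝒜
        (DirectSum.isInternal_submodule_iff_iSupIndep_and_iSup_eq_top _ |>.1
          (DirectSum.Decomposition.isInternal 𝒜)).1
        (Subalgebra.toSubmodule (Algebra.adjoin k V)) (adjoin_le_iSup_inf 𝒜 V hV))
  { one_mem := SetLike.GradedOne.one_mem (A := 𝒜)
    mul_mem := fun _ _ _ _ ha hb => SetLike.GradedMul.mul_mem (A := 𝒜) ha hb }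

/-! ### Projective space and critical density -/

section Proj

variable {k : Type u} [Field k] {t : ℕ}

/-- The homogeneous ideal `𝔪_d` of a point `d` of `ℙ^t` in `U = k[x_0, …, x_t]`, generated by the
homogeneous polynomials that vanish at `d`. -/
noncomputable def vanishingIdeal (d : Projectivization k (Fin (t + 1) → k)) :
    Ideal (MvPolynomial (Fin (t + 1)) k) :=
  Ideal.span {f | (∃ n, f.IsHomogeneous n) ∧ eval d.rep f = 0}

/-- Zariski-closed sets of points of `ℙ^t`: common zero sets of homogeneous polynomials. -/
def IsZariskiClosed (Y : Set (Projectivization k (Fin (t + 1) → k))) : Prop :=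
  ∃ F : Set (MvPolynomial (Fin (t + 1)) k), (∀ f ∈ F, ∃ n, f.IsHomogeneous n) ∧
    Y = {d | ∀ f ∈ F, eval d.rep f = 0}

/-- An infinite set of points is critically dense if every proper Zariski-closed subset contains
only finitely many of its points. -/
def IsCriticallyDense (C : Set (Projectivization k (Fin (t + 1) → k))) : Prop :=
  C.Infinite ∧ ∀ Y : Set (Projectivization k (Fin (t + 1) → k)),
    IsZariskiClosed Y → Y ≠ Set.univ → (C ∩ Y).Finite

/-- An ideal of `U` is homogeneous if it contains the homogeneous components of its elements. -/
def IsHomogeneousIdeal (I : Ideal (MvPolynomial (Fin (t + 1)) k)) : Prop :=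
  ∀ f ∈ I, ∀ n, homogeneousComponent n f ∈ I

attribute [local instance] MvPolynomial.gradedAlgebra in
theorem vanishingIdeal_isHomogeneous (d : Projectivization k (Fin (t + 1) → k)) :
    IsHomogeneousIdeal (vanishingIdeal d) := fun _ hf n =>
  have h : (vanishingIdeal d).IsHomogeneous (homogeneousSubmodule (Fin (t + 1)) k) :=
    Ideal.homogeneous_span _ _ fun _ hf => hf.1
  homogeneousComponent_mem_of_mem h hf n

attribute [local instance] MvPolynomial.gradedAlgebra in
theorem vanishingIdeal_sq_isHomogeneous (d : Projectivization k (Fin (t + 1) → k)) :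
    IsHomogeneousIdeal (vanishingIdeal d ^ 2) := fun _ hf n =>
  have h : (vanishingIdeal d).IsHomogeneous (homogeneousSubmodule (Fin (t + 1)) k) :=
    Ideal.homogeneous_span _ _ fun _ hf => hf.1
  have h2 : (vanishingIdeal d ^ 2).IsHomogeneous (homogeneousSubmodule (Fin (t + 1)) k) := by
    rw [pow_two]; exact h.mul h
  homogeneousComponent_mem_of_mem h2 hf n

end Proj

/-! ### Zhang twists of polynomial rings -/

section Twist

variable {k : Type u} [Field k] {t : ℕ}

/-- The graded automorphism `φ` of `U = k[x_0, …, x_t]` given by a linear automorphism `g` of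
`k^{t+1}`, namely `φ f = f ∘ g`. The automorphism of `ℙ^t` which corresponds to `φ` through
`𝔪_{φ(d)} = φ⁻¹(𝔪_d)` is the one induced by `g`. -/
noncomputable def subst (g : (Fin (t + 1) → k) ≃ₗ[k] (Fin (t + 1) → k)) :
    MvPolynomial (Fin (t + 1)) k →ₐ[k] MvPolynomial (Fin (t + 1)) k :=
  aeval fun i => ∑ j, C (g (Pi.single j 1) i) * X j

theorem eval_subst (g : (Fin (t + 1) → k) ≃ₗ[k] (Fin (t + 1) → k)) (x : Fin (t + 1) → k)
    (f : MvPolynomial (Fin (t + 1)) k) : eval x (subst g f) = eval (g x) f := by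
  have h : ∀ i, g x i = ∑ j, g (Pi.single j 1) i * x j := by
    intro i
    have := congrFun (congrArg g (pi_eq_sum_univ' x)) i
    rw [this]
    simp [mul_comm, Finset.sum_apply]
  induction f using MvPolynomial.induction_on with
  | C a => simp [subst]
  | add p q hp hq => simp [hp, hq]
  | mul_X p i hp =>
    rw [map_mul, map_mul, map_mul, hp]
    simp [subst, h]

theorem subst_isHomogeneous (g : (Fin (t + 1) → k) ≃ₗ[k] (Fin (t + 1) → k))
    {f : MvPolynomial (Fin (t + 1)) k} {n : ℕ} (hf : f.IsHomogeneous n) :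
    (subst g f).IsHomogeneous n := by
  have := hf.aeval (S := k) (fun i => ∑ j, C (g (Pi.single j 1) i) * X j) (n := 1)
    (fun i => IsHomogeneous.sum _ _ _ fun j _ => isHomogeneous_C_mul_X _ _)
  simpa [subst] using this

theorem subst_pow_isHomogeneous (g : (Fin (t + 1) → k) ≃ₗ[k] (Fin (t + 1) → k))
    {f : MvPolynomial (Fin (t + 1)) k} {n : ℕ} (hf : f.IsHomogeneous n) (m : ℕ) :
    ((subst g ^ m) f).IsHomogeneous n := by
  induction m with
  | zero => simpa using hf
  | succ m ih => rw [pow_succ']; exact subst_isHomogeneous g ih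

/-- The twisted product: `f * h = φⁿ(f) ∘ h` for `h` homogeneous of degree `n`, extended
additively in `h`. -/
noncomputable def twistMul (g : (Fin (t + 1) → k) ≃ₗ[k] (Fin (t + 1) → k))
    (f h : MvPolynomial (Fin (t + 1)) k) : MvPolynomial (Fin (t + 1)) k :=
  ∑ n ∈ Finset.range (h.totalDegree + 1), (subst g ^ n) f * homogeneousComponent n h

theorem twistMul_eq_sum (g : (Fin (t + 1) → k) ≃ₗ[k] (Fin (t + 1) → k))
    (f h : MvPolynomial (Fin (t + 1)) k) {N : ℕ} (hN : h.totalDegree + 1 ≤ N) :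
    twistMul g f h = ∑ n ∈ Finset.range N, (subst g ^ n) f * homogeneousComponent n h := by
  refine Finset.sum_subset (Finset.range_mono hN) fun n _ hn => ?_
  rw [homogeneousComponent_eq_zero n h (by simpa using hn), mul_zero]

theorem twistMul_of_isHomogeneous (g : (Fin (t + 1) → k) ≃ₗ[k] (Fin (t + 1) → k))
    (f : MvPolynomial (Fin (t + 1)) k) {h : MvPolynomial (Fin (t + 1)) k} {n : ℕ}
    (hh : h.IsHomogeneous n) : twistMul g f h = (subst g ^ n) f * h := by
  rw [twistMul_eq_sum g f h (N := n + 1) (Nat.succ_le_succ hh.totalDegree_le)]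
  rw [Finset.sum_eq_single n]
  · rw [homogeneousComponent_of_mem hh, if_pos rfl]
  · intro m _ hm
    rw [homogeneousComponent_of_mem hh, if_neg (by tauto), mul_zero]
  · simp

theorem twistMul_add (g : (Fin (t + 1) → k) ≃ₗ[k] (Fin (t + 1) → k))
    (f h₁ h₂ : MvPolynomial (Fin (t + 1)) k) :
    twistMul g f (h₁ + h₂) = twistMul g f h₁ + twistMul g f h₂ := by
  have h0 := totalDegree_add h₁ h₂
  set N := max h₁.totalDegree h₂.totalDegree + 1 with hN
  rw [twistMul_eq_sum g f (h₁ + h₂) (N := N) (by omega),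
    twistMul_eq_sum g f h₁ (N := N) (by omega), twistMul_eq_sum g f h₂ (N := N) (by omega),
    ← Finset.sum_add_distrib]
  exact Finset.sum_congr rfl fun n _ => by rw [map_add, mul_add]

theorem add_twistMul (g : (Fin (t + 1) → k) ≃ₗ[k] (Fin (t + 1) → k))
    (f₁ f₂ h : MvPolynomial (Fin (t + 1)) k) :
    twistMul g (f₁ + f₂) h = twistMul g f₁ h + twistMul g f₂ h := by
  simp only [twistMul, ← Finset.sum_add_distrib, map_add, add_mul]

theorem twistMul_zero (g : (Fin (t + 1) → k) ≃ₗ[k] (Fin (t + 1) → k))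
    (f : MvPolynomial (Fin (t + 1)) k) : twistMul g f 0 = 0 := by
  simp [twistMul]

theorem zero_twistMul (g : (Fin (t + 1) → k) ≃ₗ[k] (Fin (t + 1) → k))
    (f : MvPolynomial (Fin (t + 1)) k) : twistMul g 0 f = 0 := by
  simp [twistMul]

theorem homogeneous_induction {p : MvPolynomial (Fin (t + 1)) k → Prop}
    (hom : ∀ n f, f.IsHomogeneous n → p f) (add : ∀ f h, p f → p h → p (f + h))
    (f : MvPolynomial (Fin (t + 1)) k) : p f := by
  rw [← sum_homogeneousComponent f]
  exact Finset.sum_induction _ p add (hom 0 0 (isHomogeneous_zero _ _ _))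
    fun n _ => hom n _ (homogeneousComponent_isHomogeneous n f)

theorem twistMul_assoc (g : (Fin (t + 1) → k) ≃ₗ[k] (Fin (t + 1) → k))
    (a b c : MvPolynomial (Fin (t + 1)) k) :
    twistMul g (twistMul g a b) c = twistMul g a (twistMul g b c) := by
  induction c using homogeneous_induction with
  | add c₁ c₂ h₁ h₂ => simp only [twistMul_add, h₁, h₂]
  | hom n c hc =>
    induction b using homogeneous_induction with
    | add b₁ b₂ h₁ h₂ => simp only [twistMul_add, add_twistMul, h₁, h₂]
    | hom m b hb =>
      have hbc : ((subst g ^ n) b * c).IsHomogeneous (m + n) :=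
        (subst_pow_isHomogeneous g hb n).mul hc
      rw [twistMul_of_isHomogeneous g a hb, twistMul_of_isHomogeneous g _ hc,
        twistMul_of_isHomogeneous g b hc, twistMul_of_isHomogeneous g a hbc, map_mul,
        add_comm m n, pow_add, AlgHom.mul_apply, mul_assoc]

theorem twistMul_one (g : (Fin (t + 1) → k) ≃ₗ[k] (Fin (t + 1) → k))
    (f : MvPolynomial (Fin (t + 1)) k) : twistMul g f 1 = f := by
  rw [twistMul_of_isHomogeneous g f (isHomogeneous_one _ _)]
  simp

theorem one_twistMul (g : (Fin (t + 1) → k) ≃ₗ[k] (Fin (t + 1) → k))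
    (f : MvPolynomial (Fin (t + 1)) k) : twistMul g 1 f = f := by
  simp only [twistMul, map_one, one_mul, sum_homogeneousComponent]

theorem smul_twistMul (g : (Fin (t + 1) → k) ≃ₗ[k] (Fin (t + 1) → k)) (r : k)
    (f h : MvPolynomial (Fin (t + 1)) k) : twistMul g (r • f) h = r • twistMul g f h := by
  simp only [twistMul, map_smul, smul_mul_assoc, Finset.smul_sum]

theorem twistMul_smul (g : (Fin (t + 1) → k) ≃ₗ[k] (Fin (t + 1) → k)) (r : k)
    (f h : MvPolynomial (Fin (t + 1)) k) : twistMul g f (r • h) = r • twistMul g f h := by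
  induction h using homogeneous_induction with
  | add h₁ h₂ ih₁ ih₂ => simp only [smul_add, twistMul_add, ih₁, ih₂]
  | hom n h hh =>
    have : (r • h).IsHomogeneous n := (homogeneousSubmodule (Fin (t + 1)) k n).smul_mem r hh
    rw [twistMul_of_isHomogeneous g f hh, twistMul_of_isHomogeneous g f this, mul_smul_comm]

/-- The Zhang twist `S = S(φ)` of `U = k[x_0, …, x_t]`, with the same underlying vector space as
`U` and the product `f * h = φⁿ(f) ∘ h` for `h` of degree `n`. -/
def ZhangTwist (_g : (Fin (t + 1) → k) ≃ₗ[k] (Fin (t + 1) → k)) : Type u :=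
  MvPolynomial (Fin (t + 1)) k

variable (g : (Fin (t + 1) → k) ≃ₗ[k] (Fin (t + 1) → k))

noncomputable instance : AddCommGroup (ZhangTwist g) :=
  inferInstanceAs (AddCommGroup (MvPolynomial (Fin (t + 1)) k))

noncomputable instance : Module k (ZhangTwist g) :=
  inferInstanceAs (Module k (MvPolynomial (Fin (t + 1)) k))

/-- The identification of the underlying vector space of `S` with that of `U`. -/
noncomputable def toPoly : ZhangTwist g ≃ₗ[k] MvPolynomial (Fin (t + 1)) k :=
  LinearEquiv.refl k (MvPolynomial (Fin (t + 1)) k)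

noncomputable instance : Ring (ZhangTwist g) :=
  { (inferInstance : AddCommGroup (ZhangTwist g)) with
    mul := fun f h => (toPoly g).symm (twistMul g (toPoly g f) (toPoly g h))
    one := (toPoly g).symm 1
    left_distrib := twistMul_add g
    right_distrib := add_twistMul g
    zero_mul := zero_twistMul g
    mul_zero := twistMul_zero g
    mul_assoc := twistMul_assoc g
    one_mul := one_twistMul g
    mul_one := twistMul_one g }

theorem toPoly_mul (f h : ZhangTwist g) :
    toPoly g (f * h) = twistMul g (toPoly g f) (toPoly g h) := rfl

noncomputable instance : Algebra k (ZhangTwist g) :=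
  Algebra.ofModule (smul_twistMul g) (fun r f h => twistMul_smul g r f h)

/-- `S_n = U_n`. -/
noncomputable def twistDeg (n : ℕ) : Submodule k (ZhangTwist g) :=
  (homogeneousSubmodule (Fin (t + 1)) k n).comap (toPoly g).toLinearMap

theorem twistDeg_isInternal : DirectSum.IsInternal (twistDeg g) :=
  letI := MvPolynomial.decomposition (σ := Fin (t + 1)) (R := k)
  DirectSum.Decomposition.isInternal (homogeneousSubmodule (Fin (t + 1)) k)

noncomputable instance : GradedAlgebra (twistDeg g) :=
  letI : DirectSum.Decomposition (twistDeg g) := (twistDeg_isInternal g).chooseDecomposition _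
  { one_mem := isHomogeneous_one _ _
    mul_mem := fun m n a b (ha : (toPoly g a).IsHomogeneous m)
        (hb : (toPoly g b).IsHomogeneous n) => by
      change (toPoly g (a * b)).IsHomogeneous (m + n)
      rw [toPoly_mul, twistMul_of_isHomogeneous g _ hb]
      exact (subst_pow_isHomogeneous g ha n).mul hb }

/-- The left ideal `θ(I)` of `S` with the same underlying vector space as a homogeneous ideal `I`
of `U`. -/
noncomputable def twistIdeal (I : Ideal (MvPolynomial (Fin (t + 1)) k))
    (hI : IsHomogeneousIdeal I) : Ideal (ZhangTwist g) where
  carrier := {f | toPoly g f ∈ I}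
  add_mem' ha hb := I.add_mem ha hb
  zero_mem' := I.zero_mem
  smul_mem' s f hf := by
    change twistMul g (toPoly g s) (toPoly g f) ∈ I
    exact Ideal.sum_mem _ fun n _ => Ideal.mul_mem_left _ _ (hI _ hf n)

theorem twistIdeal_graded (I : Ideal (MvPolynomial (Fin (t + 1)) k))
    (hI : IsHomogeneousIdeal I) : (twistIdeal g I hI).restrictScalars k ≤
      ⨆ n, (twistIdeal g I hI).restrictScalars k ⊓ (GrMod.regular (twistDeg g)).deg n := by
  intro f hf
  have h : f = ∑ n ∈ Finset.range ((toPoly g f).totalDegree + 1),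
      (toPoly g).symm (homogeneousComponent n (toPoly g f)) := by
    rw [← map_sum, sum_homogeneousComponent, LinearEquiv.symm_apply_apply]
  rw [h]
  refine Submodule.sum_mem _ fun n _ => Submodule.mem_iSup_of_mem (Int.ofNat n) ⟨?_, ?_⟩
  · exact hI _ hf n
  · exact homogeneousComponent_isHomogeneous n (toPoly g f)

/-- The `S`-point module `P(d) = S / 𝔪_d`. -/
noncomputable def twistPointModule (d : Projectivization k (Fin (t + 1) → k)) :
    GrMod (twistDeg g) :=
  (GrMod.regular (twistDeg g)).quot (twistIdeal g (vanishingIdeal d) (vanishingIdeal_isHomogeneous d))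
    (twistIdeal_graded g _ _)

end Twist

/-! ### The algebra `R(φ, c)` -/

section R

variable {k : Type u} [Field k] {t : ℕ} (g : (Fin (t + 1) → k) ≃ₗ[k] (Fin (t + 1) → k))
  (c : Projectivization k (Fin (t + 1) → k))

/-- The points `c_i = φ^{-i}(c)`. -/
noncomputable def orbitPt (i : ℤ) : Projectivization k (Fin (t + 1) → k) := g ^ (-i) • c

/-- The codimension-one subspace `V` of `S_1 = U_1` that corresponds to `c`: the linear forms
vanishing at `c`. -/
def genSpace : Set (ZhangTwist g) := {f | f ∈ twistDeg g 1 ∧ eval c.rep (toPoly g f) = 0}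

/-- `R = R(φ, c)`, the subalgebra of `S` generated by `V`. -/
noncomputable def subalgR : Subalgebra k (ZhangTwist g) := Algebra.adjoin k (genSpace g c)

/-- `R_n = R ∩ S_n`. -/
noncomputable abbrev degR : ℕ → Submodule k (subalgR g c) :=
  GrMod.subalgDeg (twistDeg g) (subalgR g c)

noncomputable instance : GradedAlgebra (degR g c) :=
  gradedAlgebraAdjoin (twistDeg g) (genSpace g c) fun _ hf => hf.1

/-- The left ideal `R ∩ I` of `R`, for a homogeneous ideal `I` of `U`. -/
noncomputable def contractR (I : Ideal (MvPolynomial (Fin (t + 1)) k))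
    (hI : IsHomogeneousIdeal I) : Ideal (subalgR g c) :=
  (twistIdeal g I hI).comap (subalgR g c).val

/-- The left ideal `R ∩ 𝔪_d` of `R`. -/
noncomputable def interIdeal (d : Projectivization k (Fin (t + 1) → k)) : Ideal (subalgR g c) :=
  contractR g c (vanishingIdeal d) (vanishingIdeal_isHomogeneous d)

/-- The left ideal `R ∩ 𝔪_d²` of `R`, where the square is taken in the polynomial ring `U`. -/
noncomputable def interSqIdeal (d : Projectivization k (Fin (t + 1) → k)) : Ideal (subalgR g c) :=
  contractR g c (vanishingIdeal d ^ 2) (vanishingIdeal_sq_isHomogeneous d)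

/-- `P(d)`, regarded as an `R`-module. -/
noncomputable def pointModuleR (d : Projectivization k (Fin (t + 1) → k)) : GrMod (degR g c) :=
  (twistPointModule g d).restrict (subalgR g c)

end R

end PointModules

open PointModules

/-!
The product of linear forms `v_{n-1} * ⋯ * v_0` in the Zhang twist is the product of the
`φ^j(v_j)` in the polynomial ring, and `φ^j(v_j)` vanishes at `c_j` if `v_j` vanishes at `c`. Hence
`R_n` is spanned by the products `w_0 ⋯ w_{n-1}` of linear forms with `w_j(c_j) = 0`, and `R` is
understood through commutative polynomials alone.

A point module has a homogeneous basis `m_0, m_1, …`, and `v ∈ R_1` acts by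
`v m_n = φ^n(v)(x_n) m_{n+1}` for a vector `x_n` that matters only modulo `c_n` and up to a scalar
(`GrMod.IsPointModule.exists_isString`). So the module is a sequence of lines `ℓ_n` through the
points `c_n`, its isomorphism class determines these lines and is determined by them
(`IsString.isom`, `IsString.sameModulo_of_isom`). A product `w_0 ⋯ w_{n-1}` maps `m_0` to
`∏ w_j(x_j) m_n`, and this scalar has to depend on the polynomial `w_0 ⋯ w_{n-1}` only. Comparing
products that differ by a permutation of two or three factors one finds that the lines meet
pairwise, and that three of them are concurrent, as long as they are in general position
(`IsString.compatibleLines`). Since a line contains only finitely many points of the orbit, general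
position can always be reached by moving to another index, and all lines have a common point `p`,
apart from the one through `c_i` if `p = c_i` (`CompatibleLines.exists_center`).

If `p` is not one of the `c_i` the module is `P(p)`. If `p = c_i`, then the line `ℓ_i` is a free
parameter, a tangent direction `e` at `c_i`. The module `P(c_i, e)` with these lines exists: it is
the quotient of `R` by the left ideal of all `f` that vanish at `c_i`, if `f` has degree `≤ i`, or
whose derivative in the direction `e` vanishes at `c_i`, if `f` has degree `> i`
(`isCharacter_tangentFunctional`). Elements of `R` of degree `> i` vanish at `c_i` themselves, so
the Leibniz rule shows that this is a left ideal, and that in degrees `> i` the module looks like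
`P(c_i)`. By a Taylor expansion, an element of `R_{i+1}` lies in `𝔪²`, with `𝔪` the ideal of `c_i`,
exactly when all its derivatives at `c_i` vanish, which is the parametrization by hyperplanes of
`R_{i+1} / (R ∩ 𝔪²)_{i+1}`. Finally, testing `R ∩ 𝔪²` on products with two factors vanishing at
`c_i` shows that a point module whose point ideal contains it has all its lines but `ℓ_i` passing
through `c_i`.
-/

namespace PointModules

open MvPolynomial

/-! ### Compatible families of lines -/

section LinearAlgebra

variable {K E : Type*} [Field K] [AddCommGroup E] [Module K E]

/-- The vectors `x` and `y` have proportional images in `E / ⟨c⟩`, with a nonzero factor. For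
`x, y ∉ ⟨c⟩` this says that they span the same line through `c` in projective space. -/
def SameModulo (c x y : E) : Prop :=
  ∃ r : K, r ≠ 0 ∧ x - r • y ∈ Submodule.span K {c}

theorem SameModulo.refl (c x : E) : SameModulo (K := K) c x x :=
  ⟨1, one_ne_zero, by simp⟩

theorem SameModulo.symm {c x y : E} (h : SameModulo (K := K) c x y) :
    SameModulo (K := K) c y x := by
  obtain ⟨r, hr, h⟩ := h
  refine ⟨r⁻¹, inv_ne_zero hr, ?_⟩
  have := Submodule.smul_mem _ (-r⁻¹) h
  rw [smul_sub, smul_smul, neg_mul, inv_mul_cancel₀ hr] at this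
  convert this using 1
  module

theorem SameModulo.trans {c x y z : E} (h : SameModulo (K := K) c x y)
    (h' : SameModulo (K := K) c y z) : SameModulo (K := K) c x z := by
  obtain ⟨r, hr, h⟩ := h
  obtain ⟨s, hs, h'⟩ := h'
  refine ⟨r * s, mul_ne_zero hr hs, ?_⟩
  have := Submodule.add_mem _ h (Submodule.smul_mem _ r h')
  convert this using 1
  module

theorem SameModulo.of_smul {c x y : E} {r : K} (hr : r ≠ 0) (h : x = r • y) :
    SameModulo (K := K) c x y :=
  ⟨r, hr, by simp [h]⟩

theorem SameModulo.map {F : Type*} [AddCommGroup F] [Module K F] (f : E →ₗ[K] F) {c x y : E}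
    (h : SameModulo (K := K) c x y) : SameModulo (K := K) (f c) (f x) (f y) := by
  obtain ⟨r, hr, h⟩ := h
  refine ⟨r, hr, ?_⟩
  obtain ⟨s, hs⟩ := Submodule.mem_span_singleton.1 h
  exact Submodule.mem_span_singleton.2 ⟨s, by rw [← map_smul, hs, map_sub, map_smul]⟩

theorem SameModulo.of_span_eq {c c' x y : E} (hc : Submodule.span K {c} = Submodule.span K {c'})
    (h : SameModulo (K := K) c x y) : SameModulo (K := K) c' x y := by
  obtain ⟨r, hr, h⟩ := h
  exact ⟨r, hr, hc ▸ h⟩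

theorem exists_dual_pair {a b y : E} (h : y ∉ Submodule.span K {a, b}) :
    ∃ w : Module.Dual K E, w a = 0 ∧ w b = 0 ∧ w y = 1 := by
  obtain ⟨f, hf, hle⟩ := Submodule.exists_le_ker_of_notMem h
  refine ⟨(f y)⁻¹ • f, ?_, ?_, ?_⟩
  · have : f a = 0 := hle (Submodule.subset_span (by simp))
    simp [this]
  · have : f b = 0 := hle (Submodule.subset_span (by simp))
    simp [this]
  · simp [hf]

theorem exists_dual_single {a y : E} (h : y ∉ Submodule.span K {a}) :
    ∃ w : Module.Dual K E, w a = 0 ∧ w y = 1 := by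
  obtain ⟨w, h1, -, h2⟩ := exists_dual_pair (a := a) (b := a) (y := y) (by simpa using h)
  exact ⟨w, h1, h2⟩

theorem mem_span_pair_of_dual {a b y : E}
    (h : ∀ w : Module.Dual K E, w a = 0 → w b = 0 → w y = 0) : y ∈ Submodule.span K {a, b} := by
  by_contra hy
  obtain ⟨w, ha, hb, hw⟩ := exists_dual_pair hy
  exact one_ne_zero (hw.symm.trans (h w ha hb))

theorem notMem_span_pair_exchange {a b y : E} (h : b ∉ Submodule.span K {a, y})
    (hy : y ∉ Submodule.span K {a}) : y ∉ Submodule.span K {a, b} := by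
  intro h'
  refine h ?_
  rw [Set.pair_comm] at h' ⊢
  exact mem_span_insert_exchange h' hy

theorem SameModulo.mem_span_pair {c x y : E} (h : SameModulo (K := K) c x y) :
    x ∈ Submodule.span K {y, c} := by
  obtain ⟨r, -, h⟩ := h
  obtain ⟨s, hs⟩ := Submodule.mem_span_singleton.1 h
  exact Submodule.mem_span_pair.2 ⟨r, s, by rw [hs]; module⟩

theorem sameModulo_of_mem_span_pair {c x y : E} (h : x ∈ Submodule.span K {y, c})
    (hx : x ∉ Submodule.span K {c}) : SameModulo (K := K) c x y := by
  obtain ⟨r, s, hs⟩ := Submodule.mem_span_pair.1 h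
  refine ⟨r, ?_, Submodule.mem_span_singleton.2 ⟨s, by rw [← hs]; module⟩⟩
  rintro rfl
  exact hx (Submodule.mem_span_singleton.2 ⟨s, by rw [← hs]; module⟩)

/-- A family of lines, the `i`-th one through `c i` and `x i`, that satisfies the relations coming
from multiplication of linear forms: a product of linear forms, the `i`-th of which vanishes at
`c i`, is to determine the product of their values at the `x i`. Only products of two and of three
forms are recorded, with the factors permuted. -/
structure CompatibleLines (c x : ℕ → E) : Prop where
  notMem : ∀ i, x i ∉ Submodule.span K {c i}
  swap : ∀ i j, i ≠ j → ∀ u w : Module.Dual K E, u (c i) = 0 → u (c j) = 0 →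
    w (c i) = 0 → w (c j) = 0 → u (x i) * w (x j) = w (x i) * u (x j)
  rotate : ∀ i j l, i ≠ j → i ≠ l → j ≠ l → ∀ w₁ w₂ w₃ : Module.Dual K E,
    w₁ (c j) = 0 → w₁ (c l) = 0 → w₂ (c i) = 0 → w₂ (c l) = 0 → w₃ (c i) = 0 → w₃ (c j) = 0 →
    w₂ (x i) * w₃ (x j) * w₁ (x l) = w₃ (x i) * w₁ (x j) * w₂ (x l)

namespace CompatibleLines

variable {c x : ℕ → E}

/-- Two lines of a compatible family meet. -/
theorem exists_meet (h : CompatibleLines (K := K) c x) {i j : ℕ}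
    (hj : c j ∉ Submodule.span K {c i, x i}) :
    ∃ α β : K, x j - (α • c i + β • x i) ∈ Submodule.span K {c j} := by
  have hij : i ≠ j := by
    rintro rfl
    exact hj (Submodule.subset_span (by simp))
  -- the swap relation with this `u` shows that `x j` is a multiple of `x i` modulo `c i` and `c j`
  obtain ⟨u, hui, huj, hu⟩ := exists_dual_pair (notMem_span_pair_exchange hj (h.notMem i))
  have h1 : x j - u (x j) • x i ∈ Submodule.span K {c i, c j} := by
    refine mem_span_pair_of_dual fun w hwi hwj => ?_
    have := h.swap i j hij u w hui huj hwi hwj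
    rw [hu, one_mul] at this
    rw [map_sub, map_smul, this, smul_eq_mul]
    ring
  obtain ⟨a, b, hab⟩ := Submodule.mem_span_pair.1 h1
  refine ⟨a, u (x j), Submodule.mem_span_singleton.2 ⟨b, ?_⟩⟩
  rw [eq_sub_iff_add_eq] at hab
  generalize u (x j) = s at hab ⊢
  rw [← hab]
  module

/-- Three lines of a compatible family are concurrent: the points in which two of them meet the
third one coincide. -/
theorem meet_eq (h : CompatibleLines (K := K) c x) {i j l : ℕ} (hjl : j ≠ l)
    (hj : c j ∉ Submodule.span K {c i, x i}) (hl : c l ∉ Submodule.span K {c i, x i})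
    (hi : c i ∉ Submodule.span K {c j, c l}) {α β α' β' : K}
    (h1 : x j - (α • c i + β • x i) ∈ Submodule.span K {c j})
    (h2 : x l - (α' • c i + β' • x i) ∈ Submodule.span K {c l}) : β * α' = β' * α := by
  have hij : i ≠ j := by
    rintro rfl
    exact hj (Submodule.subset_span (by simp))
  have hil : i ≠ l := by
    rintro rfl
    exact hl (Submodule.subset_span (by simp))
  obtain ⟨w₁, h1j, h1l, h1i⟩ := exists_dual_pair hi
  obtain ⟨w₂, h2i, h2l, h2x⟩ := exists_dual_pair (notMem_span_pair_exchange hl (h.notMem i))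
  obtain ⟨w₃, h3i, h3j, h3x⟩ := exists_dual_pair (notMem_span_pair_exchange hj (h.notMem i))
  have key := h.rotate i j l hij hil hjl w₁ w₂ w₃ h1j h1l h2i h2l h3i h3j
  obtain ⟨a, ha⟩ := Submodule.mem_span_singleton.1 h1
  obtain ⟨b, hb⟩ := Submodule.mem_span_singleton.1 h2
  have hxj : x j = α • c i + β • x i + a • c j := by rw [ha]; module
  have hxl : x l = α' • c i + β' • x i + b • c l := by rw [hb]; module
  rw [hxj, hxl] at key
  simp only [map_add, map_smul, smul_eq_mul, h1j, h1l, h1i, h2i, h2l, h2x, h3i, h3j, h3x] at key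
  linear_combination key

/-- All but finitely many lines of a compatible family meet the `i`-th one in the same point: any
two meeting points are compared through a third line that is in general position to both. -/
theorem exists_center_of_base (h : CompatibleLines (K := K) c x)
    (hc : ∀ i j, i ≠ j → c i ∉ Submodule.span K {c j})
    (hfin : ∀ a b : E, ∀ᶠ j in Filter.cofinite, c j ∉ Submodule.span K {a, b}) (i : ℕ) :
    ∃ p : E, p ≠ 0 ∧ (p ∉ Submodule.span K {c i} → SameModulo (K := K) (c i) (x i) p) ∧
      ∀ j, c j ∉ Submodule.span K {c i, x i} → SameModulo (K := K) (c j) (x j) p := by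
  obtain ⟨j₀, hj₀⟩ := (hfin (c i) (x i)).exists
  obtain ⟨α, β, h₀⟩ := h.exists_meet hj₀
  -- the coefficients of a meeting point are not both zero
  have hne : ∀ j (α β : K), x j - (α • c i + β • x i) ∈ Submodule.span K {c j} →
      ¬ (α = 0 ∧ β = 0) := by
    rintro j α β h1 ⟨rfl, rfl⟩
    exact h.notMem j (by simpa using h1)
  have hci : c i ≠ 0 := by
    intro h0
    exact hc i (i + 1) (by omega) (by rw [h0]; exact Submodule.zero_mem _)
  refine ⟨α • c i + β • x i, ?_, ?_, ?_⟩
  · intro h0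
    by_cases hβ : β = 0
    · subst hβ
      rw [zero_smul, add_zero, smul_eq_zero] at h0
      exact hne j₀ _ _ h₀ ⟨h0.resolve_right hci, rfl⟩
    · refine h.notMem i (Submodule.mem_span_singleton.2 ⟨-β⁻¹ * α, ?_⟩)
      have h3 : x i = β⁻¹ • (α • c i + β • x i) - (β⁻¹ * α) • c i := by
        rw [smul_add, smul_smul, smul_smul, inv_mul_cancel₀ hβ]; module
      rw [h3, h0]
      module
  · intro hp
    refine (sameModulo_of_mem_span_pair ?_ hp).symm
    exact Submodule.mem_span_pair.2 ⟨β, α, by module⟩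
  · intro j hj
    obtain ⟨α', β', h'⟩ := h.exists_meet hj
    obtain ⟨l, ⟨hl, hlj⟩, hl₀⟩ :=
      (((hfin (c i) (x i)).and (hfin (c i) (c j))).and (hfin (c i) (c j₀))).exists
    obtain ⟨α'', β'', h''⟩ := h.exists_meet hl
    have hneq : ∀ m, c l ∉ Submodule.span K {c i, c m} → m ≠ l := by
      rintro m hm rfl
      exact hm (Submodule.subset_span (by simp))
    have hind : ∀ m, c m ∉ Submodule.span K {c i, x i} → c l ∉ Submodule.span K {c i, c m} →
        c i ∉ Submodule.span K {c m, c l} := by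
      intro m hm hlm
      refine notMem_span_pair_exchange (by rwa [Set.pair_comm]) (hc i m ?_)
      rintro rfl
      exact hm (Submodule.subset_span (by simp))
    have e1 := h.meet_eq (hneq j hlj) hj hl (hind j hj hlj) h' h''
    have e2 := h.meet_eq (hneq j₀ hl₀) hj₀ hl (hind j₀ hj₀ hl₀) h₀ h''
    have n1 := hne _ _ _ h'
    have n2 := hne _ _ _ h₀
    have n3 := hne _ _ _ h''
    suffices hs : ∃ r : K, r ≠ 0 ∧ α' = r * α ∧ β' = r * β by
      -- the meeting points of the `i`-th line with the lines `j` and `j₀` coincide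
      obtain ⟨r, hr, rfl, rfl⟩ := hs
      refine ⟨r, hr, ?_⟩
      convert h' using 2
      module
    by_cases hβ : β'' = 0
    · have hα : α'' ≠ 0 := fun h0 => n3 ⟨h0, hβ⟩
      have b1 : β' = 0 := by
        rw [hβ, zero_mul] at e1
        exact (mul_eq_zero.1 e1).resolve_right hα
      have b2 : β = 0 := by
        rw [hβ, zero_mul] at e2
        exact (mul_eq_zero.1 e2).resolve_right hα
      have a1 : α' ≠ 0 := fun h0 => n1 ⟨h0, b1⟩
      have a2 : α ≠ 0 := fun h0 => n2 ⟨h0, b2⟩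
      exact ⟨α' / α, div_ne_zero a1 a2, by field_simp, by rw [b1, b2, mul_zero]⟩
    · have b1 : β' ≠ 0 := by
        intro h0
        rw [h0, zero_mul] at e1
        exact n1 ⟨(mul_eq_zero.1 e1.symm).resolve_left hβ, h0⟩
      have b2 : β ≠ 0 := by
        intro h0
        rw [h0, zero_mul] at e2
        exact n2 ⟨(mul_eq_zero.1 e2.symm).resolve_left hβ, h0⟩
      refine ⟨β' / β, div_ne_zero b1 b2, ?_, by field_simp⟩
      have e3 : β * α' = β' * α := by
        apply mul_left_cancel₀ hβ
        linear_combination (-β) * e1 + β' * e2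
      field_simp
      linear_combination e3

/-- The lines of a compatible family have a common point `p`, except that the line through `c i`
is arbitrary if `p = c i`. -/
theorem exists_center (h : CompatibleLines (K := K) c x)
    (hc : ∀ i j, i ≠ j → c i ∉ Submodule.span K {c j})
    (hfin : ∀ a b : E, ∀ᶠ j in Filter.cofinite, c j ∉ Submodule.span K {a, b}) :
    ∃ p : E, p ≠ 0 ∧ ∀ i, p ∉ Submodule.span K {c i} → SameModulo (K := K) (c i) (x i) p := by
  obtain ⟨p, hp, -, hpj⟩ := h.exists_center_of_base hc hfin 0
  refine ⟨p, hp, fun i hpi => ?_⟩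
  obtain ⟨q, hq, hqi, hqj⟩ := h.exists_center_of_base hc hfin i
  -- all but finitely many lines pass through both `p` and `q`
  obtain ⟨j, ⟨hj0, hji⟩, hjpq⟩ :=
    (((hfin (c 0) (x 0)).and (hfin (c i) (x i))).and (hfin p q)).exists
  have hqp : q ∈ Submodule.span K {p} := by
    by_contra hcon
    have := ((hqj j hji).symm.trans (hpj j hj0)).mem_span_pair
    exact notMem_span_pair_exchange hjpq hcon this
  obtain ⟨r, rfl⟩ := Submodule.mem_span_singleton.1 hqp
  have hr : r ≠ 0 := by
    rintro rfl
    exact hq (zero_smul _ _)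
  refine (hqi fun hm => hpi ?_).trans (SameModulo.of_smul hr rfl)
  have := Submodule.smul_mem _ r⁻¹ hm
  rwa [smul_smul, inv_mul_cancel₀ hr, one_smul] at this

end CompatibleLines

end LinearAlgebra

/-! ### Linear forms and the generators of `R` -/

section LinearForms

variable {k : Type u} [Field k] {t : ℕ}

/-- The linear form `w`, as a polynomial of degree `1`. -/
noncomputable def linForm :
    Module.Dual k (Fin (t + 1) → k) →ₗ[k] MvPolynomial (Fin (t + 1)) k where
  toFun w := ∑ i, C (w (Pi.single i 1)) * X i
  map_add' w w' := by simp [add_mul, Finset.sum_add_distrib]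
  map_smul' r w := by simp [Finset.smul_sum, smul_eq_C_mul, mul_assoc]

theorem linForm_apply (w : Module.Dual k (Fin (t + 1) → k)) :
    linForm w = ∑ i, C (w (Pi.single i 1)) * X i := rfl

theorem dual_apply_eq_sum {n : ℕ} (w : Module.Dual k (Fin n → k)) (x : Fin n → k) :
    w x = ∑ i, w (Pi.single i 1) * x i := by
  conv_lhs => rw [pi_eq_sum_univ' x]
  simp [mul_comm]

@[simp]
theorem eval_linForm (w : Module.Dual k (Fin (t + 1) → k)) (x : Fin (t + 1) → k) :
    eval x (linForm w) = w x := by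
  rw [dual_apply_eq_sum, linForm_apply]
  simp

theorem linForm_isHomogeneous (w : Module.Dual k (Fin (t + 1) → k)) :
    (linForm w).IsHomogeneous 1 :=
  IsHomogeneous.sum _ _ _ fun _ _ => isHomogeneous_C_mul_X _ _

theorem exists_linForm_eq {f : MvPolynomial (Fin (t + 1)) k} (hf : f.IsHomogeneous 1) :
    ∃ w, linForm w = f := by
  have h : homogeneousSubmodule (Fin (t + 1)) k 1 ≤
      LinearMap.range (linForm (k := k) (t := t)) := by
    rw [homogeneousSubmodule_one_eq_span_X, Submodule.span_le]
    rintro _ ⟨i, rfl⟩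
    refine ⟨LinearMap.proj i, ?_⟩
    rw [linForm_apply, Finset.sum_eq_single i]
    · simp
    · intro j _ hj
      simp [hj.symm]
    · simp
  exact h hf

variable (g : (Fin (t + 1) → k) ≃ₗ[k] (Fin (t + 1) → k))

theorem subst_linForm (w : Module.Dual k (Fin (t + 1) → k)) :
    subst g (linForm w) = linForm (w ∘ₗ g.toLinearMap) := by
  rw [linForm_apply, linForm_apply, map_sum]
  simp only [subst, map_mul, aeval_X, Finset.mul_sum, algHom_C, algebraMap_eq]
  rw [Finset.sum_comm]
  refine Finset.sum_congr rfl fun j _ => ?_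
  simp only [← mul_assoc, ← Finset.sum_mul, ← map_mul, ← map_sum]
  rw [LinearMap.comp_apply, dual_apply_eq_sum w]
  rfl

theorem subst_pow_linForm (n : ℕ) (w : Module.Dual k (Fin (t + 1) → k)) :
    (subst g ^ n) (linForm w) = linForm (w ∘ₗ (g ^ n).toLinearMap) := by
  induction n with
  | zero => rfl
  | succ n ih =>
    rw [pow_succ', AlgHom.mul_apply, ih, subst_linForm, pow_succ]
    rfl

variable (c : Projectivization k (Fin (t + 1) → k))

/-- The linear forms on `k^{t+1}` that vanish at the point `c`. -/
noncomputable def formsAt : Submodule k (Module.Dual k (Fin (t + 1) → k)) :=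
  LinearMap.ker (Module.Dual.eval k (Fin (t + 1) → k) c.rep)

variable {c} in
theorem mem_formsAt {u : Module.Dual k (Fin (t + 1) → k)} : u ∈ formsAt c ↔ u c.rep = 0 :=
  Iff.rfl

/-- The generator of `R` given by a linear form that vanishes at `c`. -/
noncomputable def gen : formsAt c →ₗ[k] subalgR g c where
  toFun u := ⟨(toPoly g).symm (linForm u), Algebra.subset_adjoin
    ⟨linForm_isHomogeneous (u : Module.Dual k (Fin (t + 1) → k)),
      (eval_linForm (u : Module.Dual k (Fin (t + 1) → k)) c.rep).trans u.2⟩⟩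
  map_add' u v := Subtype.ext (by simp)
  map_smul' r u := Subtype.ext (by simp)

theorem toPoly_gen (u : formsAt c) : toPoly g (gen g c u : ZhangTwist g) = linForm u := rfl

theorem gen_mem (u : formsAt c) : gen g c u ∈ degR g c 1 :=
  linForm_isHomogeneous (u : Module.Dual k (Fin (t + 1) → k))

theorem toPoly_mul_of_mem {n : ℕ} (b : ZhangTwist g) {a : ZhangTwist g} (ha : a ∈ twistDeg g n) :
    toPoly g (b * a) = (subst g ^ n) (toPoly g b) * toPoly g a :=
  twistMul_of_isHomogeneous g _ ha

theorem toPoly_gen_mul (u : formsAt c) {n : ℕ} {a : subalgR g c} (ha : a ∈ degR g c n) :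
    toPoly g ((gen g c u * a : subalgR g c) : ZhangTwist g) =
      linForm ((u : Module.Dual k (Fin (t + 1) → k)) ∘ₗ (g ^ n).toLinearMap) *
        toPoly g (a : ZhangTwist g) := by
  rw [← subst_pow_linForm]
  exact toPoly_mul_of_mem g _ ha

theorem gen_mul_mem (u : formsAt c) {n : ℕ} {a : subalgR g c} (ha : a ∈ degR g c n) :
    gen g c u * a ∈ degR g c (n + 1) := by
  rw [add_comm]
  exact SetLike.mul_mem_graded (gen_mem g c u) ha

/-- `R_n = V R_{n-1}`, with `R_0 = k`, as an induction principle. -/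
theorem degR_induction {P : ℕ → subalgR g c → Prop}
    (zero : ∀ n, P n 0) (add : ∀ n a b, P n a → P n b → P n (a + b))
    (smul : ∀ n (r : k) a, P n a → P n (r • a)) (one : P 0 1)
    (gen_mul : ∀ n u a, a ∈ degR g c n → P n a → P (n + 1) (gen g c u * a))
    {n : ℕ} {a : subalgR g c} (ha : a ∈ degR g c n) : P n a := by
  let W : ℕ → Submodule k (subalgR g c) := fun n =>
    { carrier := {a | a ∈ degR g c n ∧ P n a}
      add_mem' := fun ha hb => ⟨add_mem ha.1 hb.1, add n _ _ ha.2 hb.2⟩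
      zero_mem' := ⟨zero_mem _, zero n⟩
      smul_mem' := fun r a ha => ⟨Submodule.smul_mem _ r ha.1, smul n r a ha.2⟩ }
  have hgen : ∀ u, ∀ z ∈ ⨆ n, W n, gen g c u * z ∈ ⨆ n, W n := by
    intro u z hz
    induction hz using Submodule.iSup_induction' with
    | zero => rw [mul_zero]; exact zero_mem _
    | add b c _ _ hb hc => rw [mul_add]; exact add_mem hb hc
    | mem n b hb =>
      exact Submodule.mem_iSup_of_mem (n + 1)
        ⟨gen_mul_mem g c _ hb.1, gen_mul n _ b hb.1 hb.2⟩
  have key : ∀ b : ZhangTwist g, (hb : b ∈ subalgR g c) → (⟨b, hb⟩ : subalgR g c) ∈ ⨆ n, W n := by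
    have hmon : ∀ b (hb : b ∈ Submonoid.closure (genSpace g c)),
        ∃ hb' : b ∈ subalgR g c, (⟨b, hb'⟩ : subalgR g c) ∈ ⨆ n, W n := by
      intro b hb
      induction hb using Submonoid.closure_induction_left with
      | one =>
        exact ⟨one_mem _, Submodule.mem_iSup_of_mem 0 ⟨SetLike.GradedOne.one_mem, one⟩⟩
      | mul_left x hx y hy ih =>
        obtain ⟨hy', ih⟩ := ih
        refine ⟨mul_mem (Algebra.subset_adjoin hx) hy', ?_⟩
        obtain ⟨u, hu⟩ := exists_linForm_eq hx.1
        have hu0 : eval c.rep (linForm u) = 0 := by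
          rw [hu]
          exact hx.2
        rw [eval_linForm] at hu0
        have hxu : x = (gen g c ⟨u, hu0⟩ : ZhangTwist g) := (toPoly g).injective hu.symm
        have hxy : (⟨x * y, mul_mem (Algebra.subset_adjoin hx) hy'⟩ : subalgR g c) =
            gen g c ⟨u, hu0⟩ * ⟨y, hy'⟩ := Subtype.ext (congrArg (· * y) hxu)
        rw [hxy]
        exact hgen _ _ ih
    have hspan : Subalgebra.toSubmodule (subalgR g c) ≤
        (⨆ n, W n).map (subalgR g c).val.toLinearMap := by
      refine (Algebra.adjoin_eq_span k (genSpace g c)).le.trans (Submodule.span_le.2 ?_)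
      intro b hb
      obtain ⟨hb', h⟩ := hmon b hb
      exact ⟨_, h, rfl⟩
    intro b hb
    obtain ⟨b', hb', h⟩ := hspan hb
    have : b' = ⟨b, hb⟩ := Subtype.ext h
    exact this ▸ hb'
  -- the component of degree `n` of an element of `⨆ m, W m` lies in `W n`
  have hcomp : ∀ b ∈ ⨆ m, W m, ((DirectSum.decompose (degR g c) b n : degR g c n) : subalgR g c) ∈
      W n := by
    intro b hb
    induction hb using Submodule.iSup_induction' with
    | zero => simp
    | add b c _ _ hb hc => simpa [DirectSum.decompose_add] using add_mem hb hc
    | mem m b hb =>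
      by_cases hmn : m = n
      · subst hmn
        rw [DirectSum.decompose_of_mem_same _ hb.1]
        exact hb
      · rw [DirectSum.decompose_of_mem_ne _ hb.1 hmn]
        exact zero_mem _
  have := hcomp a (key a a.2)
  rw [DirectSum.decompose_of_mem_same _ ha] at this
  exact this.2

/-- The product `u_{n-1} * ⋯ * u_0` in `R` of linear forms vanishing at `c`. -/
noncomputable def word (u : ℕ → formsAt c) : ℕ → subalgR g c
  | 0 => 1
  | n + 1 => gen g c (u n) * word u n

theorem word_mem (u : ℕ → formsAt c) (n : ℕ) : word g c u n ∈ degR g c n := by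
  induction n with
  | zero => exact SetLike.GradedOne.one_mem
  | succ n ih => exact gen_mul_mem g c _ ih

theorem toPoly_word (u : ℕ → formsAt c) (n : ℕ) :
    toPoly g (word g c u n : ZhangTwist g) = ∏ j ∈ Finset.range n,
      linForm ((u j : Module.Dual k (Fin (t + 1) → k)) ∘ₗ (g ^ j).toLinearMap) := by
  induction n with
  | zero => rfl
  | succ n ih =>
    rw [Finset.prod_range_succ, ← ih, mul_comm]
    exact toPoly_gen_mul g c (u n) (word_mem g c u n)

/-! ### The orbit of `c` -/

/-- A vector that represents the point `c_i = φ^{-i}(c)`. -/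
noncomputable def orbitVec (i : ℤ) : Fin (t + 1) → k := (g ^ (-i)) c.rep

theorem orbitVec_ne_zero (i : ℤ) : orbitVec g c i ≠ 0 :=
  (LinearEquiv.map_ne_zero_iff _).2 c.rep_nonzero

theorem mk_orbitVec (i : ℤ) :
    Projectivization.mk k (orbitVec g c i) (orbitVec_ne_zero g c i) = orbitPt g c i := by
  rw [orbitPt]
  conv_rhs => rw [← c.mk_rep]
  rfl

theorem eq_orbitPt_iff (d : Projectivization k (Fin (t + 1) → k)) (i : ℤ) :
    d = orbitPt g c i ↔ d.rep ∈ Submodule.span k {orbitVec g c i} := by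
  rw [← mk_orbitVec]
  conv_lhs => rw [← d.mk_rep]
  rw [Projectivization.mk_eq_mk_iff', Submodule.mem_span_singleton]

theorem exists_orbitPt_rep (i : ℤ) :
    ∃ r : k, r ≠ 0 ∧ (orbitPt g c i).rep = r • orbitVec g c i := by
  obtain ⟨r, hr⟩ := Submodule.mem_span_singleton.1 ((eq_orbitPt_iff g c _ i).1 rfl)
  refine ⟨r, ?_, hr.symm⟩
  rintro rfl
  exact (orbitPt g c i).rep_nonzero (by rw [← hr, zero_smul])

theorem span_orbitPt_rep (i : ℤ) :
    Submodule.span k {(orbitPt g c i).rep} = Submodule.span k {orbitVec g c i} := by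
  obtain ⟨r, hr, h⟩ := exists_orbitPt_rep g c i
  rw [h, Submodule.span_singleton_smul_eq (IsUnit.mk0 r hr)]

theorem pow_orbitVec (n : ℕ) (i : ℤ) :
    (g ^ n) (orbitVec g c i) = orbitVec g c (i - n) := by
  rw [orbitVec, orbitVec, ← LinearEquiv.mul_apply, ← zpow_natCast, ← zpow_add]
  congr 2
  ring

theorem orbitVec_zero : orbitVec g c 0 = c.rep := by
  simp [orbitVec]

theorem pow_orbitVec_self (n : ℕ) : (g ^ n) (orbitVec g c n) = c.rep := by
  rw [pow_orbitVec, sub_self, orbitVec_zero]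

variable {g} in
theorem pow_mem_span_iff (n : ℕ) {x y : Fin (t + 1) → k} :
    (g ^ n) x ∈ Submodule.span k {(g ^ n) y} ↔ x ∈ Submodule.span k {y} := by
  simp only [Submodule.mem_span_singleton, ← map_smul, (g ^ n).injective.eq_iff]

theorem pow_mem_span_rep_iff (n : ℕ) (x : Fin (t + 1) → k) :
    (g ^ n) x ∈ Submodule.span k {c.rep} ↔ x ∈ Submodule.span k {orbitVec g c n} := by
  have := pow_mem_span_iff (g := g) n (x := x) (y := orbitVec g c n)
  rwa [pow_orbitVec_self] at this

variable {c} in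
theorem formsAt_apply_eq_zero (u : formsAt c) {x : Fin (t + 1) → k}
    (hx : x ∈ Submodule.span k {c.rep}) : (u : Module.Dual k (Fin (t + 1) → k)) x = 0 := by
  obtain ⟨r, rfl⟩ := Submodule.mem_span_singleton.1 hx
  rw [map_smul, mem_formsAt.1 u.2, smul_zero]

/-- `R_n` consists of forms that vanish at `c_0, …, c_{n-1}`. -/
theorem eval_eq_zero_of_mem_degR {n : ℕ} {a : subalgR g c} (ha : a ∈ degR g c n) :
    ∀ j : ℕ, j < n → ∀ p ∈ Submodule.span k {orbitVec g c j},
      eval p (toPoly g (a : ZhangTwist g)) = 0 := by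
  refine degR_induction g c (P := fun n a => ∀ j : ℕ, j < n →
    ∀ p ∈ Submodule.span k {orbitVec g c j},
      eval p (toPoly g (a : ZhangTwist g)) = 0) ?_ ?_ ?_ ?_ ?_ ha
  · intro n j _ p _
    simp
  · intro n a b iha ihb j hj p hp
    simp [iha j hj p hp, ihb j hj p hp]
  · intro n r a ih j hj p hp
    simp [ih j hj p hp, smul_eval]
  · intro j hj
    omega
  · intro n u a ha ih j hj p hp
    rw [toPoly_gen_mul g c u ha, map_mul, eval_linForm]
    rcases Nat.lt_succ_iff_lt_or_eq.1 hj with hj | rfl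
    · rw [ih j hj p hp, mul_zero]
    · exact mul_eq_zero_of_left
        (formsAt_apply_eq_zero u ((pow_mem_span_rep_iff g c j p).2 hp)) _

variable {g c}

theorem orbitPt_injective (h : (Set.range (orbitPt g c)).Infinite) :
    Function.Injective (orbitPt g c) := by
  intro i j hij
  by_contra hne
  wlog hlt : i < j generalizing i j
  · exact this hij.symm (Ne.symm hne) (by omega)
  apply h
  -- two equal points of the orbit make it periodic
  have hper : g ^ (j - i) • c = c := by
    have h1 : g ^ j • orbitPt g c i = g ^ j • orbitPt g c j := by rw [hij]
    rw [orbitPt, orbitPt, smul_smul, smul_smul, ← zpow_add, ← zpow_add] at h1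
    simpa [sub_eq_add_neg] using h1
  have hmul : ∀ q : ℤ, g ^ ((j - i) * q) • c = c := by
    intro q
    have h1 : g ^ (j - i) ∈ MulAction.stabilizer _ c := hper
    rw [zpow_mul]
    exact Subgroup.zpow_mem _ h1 q
  refine ((Set.finite_Ico 0 (j - i)).image fun m : ℤ => g ^ m • c).subset ?_
  rintro _ ⟨m, rfl⟩
  refine ⟨(-m) % (j - i), ⟨Int.emod_nonneg _ (by omega), Int.emod_lt_of_pos _ (by omega)⟩, ?_⟩
  have h2 : -m = (-m) % (j - i) + (j - i) * ((-m) / (j - i)) := (Int.emod_add_mul_ediv _ _).symm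
  change g ^ ((-m) % (j - i)) • c = g ^ (-m) • c
  conv_rhs => rw [h2, zpow_add, mul_smul, hmul]

theorem orbitVec_notMem_span (h : IsCriticallyDense (Set.range (orbitPt g c))) (i j : ℤ)
    (hij : i ≠ j) : orbitVec g c i ∉ Submodule.span k {orbitVec g c j} := by
  rw [← span_orbitPt_rep]
  intro hm
  refine hij (orbitPt_injective h.1 ?_)
  rw [← mk_orbitVec, ← (orbitPt g c j).mk_rep, Projectivization.mk_eq_mk_iff']
  exact Submodule.mem_span_singleton.1 hm

/-- A line of `ℙ^t`, `t ≥ 2`, contains only finitely many points of a critically dense orbit. -/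
theorem eventually_orbitVec_notMem (ht : 2 ≤ t)
    (h : IsCriticallyDense (Set.range (orbitPt g c))) (a b : Fin (t + 1) → k) :
    ∀ᶠ j : ℕ in Filter.cofinite, orbitVec g c j ∉ Submodule.span k {a, b} := by
  let Y : Set (Projectivization k (Fin (t + 1) → k)) := {d | d.rep ∈ Submodule.span k {a, b}}
  have hY : IsZariskiClosed Y := by
    refine ⟨{f | ∃ w : Module.Dual k (Fin (t + 1) → k), w a = 0 ∧ w b = 0 ∧ f = linForm w}, ?_, ?_⟩
    · rintro _ ⟨w, -, -, rfl⟩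
      exact ⟨1, linForm_isHomogeneous w⟩
    · ext d
      constructor
      · rintro hd _ ⟨w, ha, hb, rfl⟩
        obtain ⟨r, s, hrs⟩ := Submodule.mem_span_pair.1 hd
        rw [eval_linForm, ← hrs, map_add, map_smul, map_smul, ha, hb, smul_zero, smul_zero,
          add_zero]
      · intro hd
        refine mem_span_pair_of_dual fun w ha hb => ?_
        rw [← eval_linForm]
        exact hd _ ⟨w, ha, hb, rfl⟩
  have hYne : Y ≠ Set.univ := by
    intro hu
    have hle : (⊤ : Submodule k (Fin (t + 1) → k)) ≤ Submodule.span k {a, b} := by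
      intro x _
      by_cases hx : x = 0
      · rw [hx]
        exact zero_mem _
      · have hd : (Projectivization.mk k x hx).rep ∈ Submodule.span k {a, b} := by
          have : Projectivization.mk k x hx ∈ Y := by rw [hu]; trivial
          exact this
        obtain ⟨r, hr⟩ := Projectivization.exists_smul_eq_mk_rep k x hx
        have h1 := Submodule.smul_mem _ ((r⁻¹ : kˣ) : k) hd
        rw [← hr] at h1
        simpa [Units.smul_def, smul_smul] using h1
    have h1 : Module.finrank k (Submodule.span k ({a, b} : Set (Fin (t + 1) → k))) ≤ 2 := by
      classical
      have := finrank_span_le_card (R := k) ({a, b} : Set (Fin (t + 1) → k))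
      refine this.trans ?_
      rw [Set.toFinset_insert, Set.toFinset_singleton]
      exact Finset.card_le_two
    rw [top_le_iff.1 hle, finrank_top, Module.finrank_fin_fun] at h1
    omega
  have hfin := h.2 Y hY hYne
  have hinj : Function.Injective fun j : ℕ => orbitPt g c j :=
    (orbitPt_injective h.1).comp Nat.cast_injective
  refine (Set.Finite.preimage hinj.injOn hfin).subset ?_
  intro j hj
  have hj' : orbitVec g c j ∈ Submodule.span k {a, b} := not_not.1 hj
  refine ⟨⟨_, rfl⟩, ?_⟩
  obtain ⟨r, -, hr⟩ := exists_orbitPt_rep g c j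
  change (orbitPt g c j).rep ∈ Submodule.span k {a, b}
  rw [hr]
  exact Submodule.smul_mem _ _ hj'

end LinearForms

/-! ### Cyclic graded modules -/

namespace GrMod

variable {k : Type u} {A : Type w} [Field k] [Ring A] [Algebra k A] {𝒜 : ℕ → Submodule k A}

theorem exists_proj (M : GrMod.{u, v, w} 𝒜) (n : ℤ) : ∃ π : M.carrier →ₗ[k] M.carrier,
    (∀ x ∈ M.deg n, π x = x) ∧ ∀ j, j ≠ n → ∀ x ∈ M.deg j, π x = 0 := by
  let := M.isInternal.chooseDecomposition
  refine ⟨(M.deg n).subtype ∘ₗ DirectSum.component k ℤ (fun i => M.deg i) n ∘ₗ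
    (DirectSum.decomposeLinearEquiv M.deg).toLinearMap, ?_, ?_⟩
  · intro x hx
    exact DirectSum.decompose_of_mem_same M.deg hx
  · intro j hj x hx
    exact DirectSum.decompose_of_mem_ne M.deg hx hj

theorem eq_zero_of_mem_tailSub [GradedAlgebra 𝒜] (M : GrMod.{u, v, w} 𝒜) {n j : ℤ} (hj : j < n)
    {x : M.carrier} (hx : x ∈ M.deg j) (hx' : x ∈ M.tailSub n) : x = 0 := by
  obtain ⟨π, h1, h2⟩ := M.exists_proj j
  have h3 : (⨆ (i : ℤ) (_ : n ≤ i), M.deg i) ≤ LinearMap.ker π :=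
    iSup₂_le fun i hi y hy => h2 i (by omega) y hy
  rw [← h1 x hx]
  exact h3 hx'

theorem mem_tailSub [GradedAlgebra 𝒜] (M : GrMod.{u, v, w} 𝒜) {n j : ℤ} (hj : n ≤ j)
    {x : M.carrier} (hx : x ∈ M.deg j) : x ∈ M.tailSub n :=
  le_iSup₂_of_le (f := fun (i : ℤ) (_ : n ≤ i) => M.deg i) j hj le_rfl hx

open scoped Classical in
theorem smul_eq_sum [GradedAlgebra 𝒜] (M : GrMod.{u, v, w} 𝒜) (a : A) (x : M.carrier) :
    a • x = ∑ n ∈ (DirectSum.decompose 𝒜 a).support, (DirectSum.decompose 𝒜 a n : A) • x := by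
  conv_lhs => rw [← DirectSum.sum_support_decompose 𝒜 a]
  rw [Finset.sum_smul]

/-- A homogeneous component of `a • x`, for homogeneous `x`. -/
theorem proj_smul [GradedAlgebra 𝒜] (M : GrMod.{u, v, w} 𝒜) {s : ℤ} {x : M.carrier}
    (hx : x ∈ M.deg s) (a : A) (m : ℕ) {π : M.carrier →ₗ[k] M.carrier}
    (h1 : ∀ z ∈ M.deg (s + m), π z = z) (h2 : ∀ j, j ≠ s + m → ∀ z ∈ M.deg j, π z = 0) :
    π (a • x) = (DirectSum.decompose 𝒜 a m : A) • x := by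
  classical
  rw [M.smul_eq_sum a x, map_sum, Finset.sum_eq_single m]
  · exact h1 _ (M.smul_mem (SetLike.coe_mem _) hx)
  · intro n _ hn
    exact h2 (s + n) (by omega) _ (M.smul_mem (SetLike.coe_mem _) hx)
  · intro hm
    rw [DFinsupp.notMem_support_iff.1 hm, ZeroMemClass.coe_zero, zero_smul, map_zero]

theorem smul_eq_zero_iff_decompose [GradedAlgebra 𝒜] (M : GrMod.{u, v, w} 𝒜) {s : ℤ}
    {x : M.carrier} (hx : x ∈ M.deg s) (a : A) :
    a • x = 0 ↔ ∀ n : ℕ, (DirectSum.decompose 𝒜 a n : A) • x = 0 := by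
  constructor
  · intro h n
    obtain ⟨π, h1, h2⟩ := M.exists_proj (s + n)
    rw [← M.proj_smul hx a n h1 h2, h, map_zero]
  · intro h
    rw [M.smul_eq_sum]
    exact Finset.sum_eq_zero fun n _ => h n

theorem smul_mem_tailSub_iff [GradedAlgebra 𝒜] (M : GrMod.{u, v, w} 𝒜)
    {x : M.carrier} (hx : x ∈ M.deg 0) (a : A) (j : ℤ) : a • x ∈ M.tailSub j ↔
      ∀ n : ℕ, (n : ℤ) < j → (DirectSum.decompose 𝒜 a n : A) • x = 0 := by
  constructor
  · intro h n hn
    obtain ⟨π, h1, h2⟩ := M.exists_proj (0 + n)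
    rw [← M.proj_smul hx a n h1 h2]
    have h3 : (⨆ (i : ℤ) (_ : j ≤ i), M.deg i) ≤ LinearMap.ker π :=
      iSup₂_le fun i hi y hy => h2 i (by omega) y hy
    exact h3 h
  · intro h
    rw [M.smul_eq_sum]
    refine Submodule.sum_mem _ fun n _ => ?_
    by_cases hn : (n : ℤ) < j
    · rw [h n hn]
      exact zero_mem _
    · exact M.mem_tailSub (by omega) (M.smul_mem (SetLike.coe_mem _) hx)

/-- In a module generated by `x` in degree `s`, the component of degree `s + m` is `A_m x`. -/
theorem exists_smul_of_mem_deg [GradedAlgebra 𝒜] (M : GrMod.{u, v, w} 𝒜) {s : ℤ}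
    {x : M.carrier} (hx : x ∈ M.deg s) (hspan : Submodule.span A {x} = ⊤) (m : ℕ)
    {z : M.carrier} (hz : z ∈ M.deg (s + m)) : ∃ a ∈ 𝒜 m, z = a • x := by
  obtain ⟨a, rfl⟩ := Submodule.mem_span_singleton.1 (hspan ▸ Submodule.mem_top : z ∈ _)
  obtain ⟨π, h1, h2⟩ := M.exists_proj (s + m)
  exact ⟨_, SetLike.coe_mem (DirectSum.decompose 𝒜 a m),
    by rw [← M.proj_smul hx a m h1 h2, h1 _ hz]⟩

theorem deg_eq_bot_of_lt [GradedAlgebra 𝒜] (M : GrMod.{u, v, w} 𝒜) {s : ℤ}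
    {x : M.carrier} (hx : x ∈ M.deg s) (hspan : Submodule.span A {x} = ⊤) {j : ℤ} (hj : j < s) :
    M.deg j = ⊥ := by
  rw [eq_bot_iff]
  intro z hz
  obtain ⟨π, h1, h2⟩ := M.exists_proj j
  obtain ⟨a, rfl⟩ := Submodule.mem_span_singleton.1 (hspan ▸ Submodule.mem_top : z ∈ _)
  rw [Submodule.mem_bot, ← h1 _ hz, M.smul_eq_sum, map_sum]
  exact Finset.sum_eq_zero fun n _ =>
    h2 (s + n) (by omega) _ (M.smul_mem (SetLike.coe_mem _) hx)

theorem map_mem_deg [GradedAlgebra 𝒜] {M : GrMod.{u, v, w} 𝒜} {N : GrMod.{u, v', w} 𝒜} {s : ℤ}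
    {x : M.carrier} (hx : x ∈ M.deg s) (hspan : Submodule.span A {x} = ⊤)
    (f : M.carrier →ₗ[A] N.carrier) (hf : f x ∈ N.deg s) {n : ℤ} {z : M.carrier}
    (hz : z ∈ M.deg n) : f z ∈ N.deg n := by
  rcases lt_or_ge n s with hn | hn
  · rw [M.deg_eq_bot_of_lt hx hspan hn, Submodule.mem_bot] at hz
    rw [hz, map_zero]
    exact zero_mem _
  · obtain ⟨m, rfl⟩ := Int.le.dest hn
    obtain ⟨a, ha, rfl⟩ := M.exists_smul_of_mem_deg hx hspan m hz
    rw [map_smul]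
    exact N.smul_mem ha hf

/-- Two graded modules that are generated by elements of the same degree are isomorphic if the
generators are annihilated by the same homogeneous elements. -/
theorem isom_of_cyclic [GradedAlgebra 𝒜] {M : GrMod.{u, v, w} 𝒜} {N : GrMod.{u, v', w} 𝒜} {s : ℤ}
    {x : M.carrier} {y : N.carrier} (hx : x ∈ M.deg s) (hy : y ∈ N.deg s)
    (hxspan : Submodule.span A {x} = ⊤) (hyspan : Submodule.span A {y} = ⊤)
    (h : ∀ n, ∀ a ∈ 𝒜 n, a • x = 0 ↔ a • y = 0) : M.Isom N := by
  have hker : LinearMap.ker (LinearMap.toSpanSingleton A M.carrier x) =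
      LinearMap.ker (LinearMap.toSpanSingleton A N.carrier y) := by
    ext a
    simp only [LinearMap.mem_ker, LinearMap.toSpanSingleton_apply]
    rw [M.smul_eq_zero_iff_decompose hx, N.smul_eq_zero_iff_decompose hy]
    exact forall_congr' fun n => h n _ (SetLike.coe_mem _)
  have hsx : Function.Surjective (LinearMap.toSpanSingleton A M.carrier x) := by
    rw [← LinearMap.range_eq_top, ← hxspan, LinearMap.range_toSpanSingleton]
  have hsy : Function.Surjective (LinearMap.toSpanSingleton A N.carrier y) := by
    rw [← LinearMap.range_eq_top, ← hyspan, LinearMap.range_toSpanSingleton]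
  let e₁ := LinearMap.quotKerEquivOfSurjective _ hsx
  let e₂ := LinearMap.quotKerEquivOfSurjective _ hsy
  let e := (e₁.symm.trans (Submodule.quotEquivOfEq _ _ hker)).trans e₂
  have hex : e x = y := by
    have h1 : e₁.symm x = Submodule.Quotient.mk 1 := by
      rw [LinearEquiv.symm_apply_eq]
      change x = (1 : A) • x
      rw [one_smul]
    change e₂ (Submodule.quotEquivOfEq _ _ hker (e₁.symm x)) = y
    rw [h1]
    change (1 : A) • y = y
    rw [one_smul]
  have hey : e.symm y = x := by rw [LinearEquiv.symm_apply_eq, hex]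
  refine ⟨e, fun n z => ⟨fun hz => ?_, fun hz => ?_⟩⟩
  · exact map_mem_deg hx hxspan e.toLinearMap (hex ▸ hy) hz
  · have := map_mem_deg hy hyspan e.symm.toLinearMap (hey ▸ hx) hz
    simpa using this

theorem Isom.symm {M : GrMod.{u, v, w} 𝒜} {N : GrMod.{u, v', w} 𝒜} (h : M.Isom N) :
    N.Isom M := by
  obtain ⟨f, hf⟩ := h
  exact ⟨f.symm, fun n x => by rw [hf, LinearEquiv.apply_symm_apply]⟩

theorem Isom.pointIdeal_eq {M : GrMod.{u, v, w} 𝒜} {N : GrMod.{u, v', w} 𝒜} (h : M.Isom N) :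
    M.pointIdeal = N.pointIdeal := by
  obtain ⟨f, hf⟩ := h
  ext a
  constructor
  · intro ha y hy
    have h1 := ha (f.symm y) ((hf 0 _).2 (by simpa using hy))
    simpa using congrArg f h1
  · intro ha x hx
    have h1 := ha (f x) ((hf 0 x).1 hx)
    rwa [← map_smul, LinearEquiv.map_eq_zero_iff] at h1

end GrMod

/-! ### Modules with a basis in consecutive degrees -/

section Strings

variable {k : Type u} [Field k] {t : ℕ} (g : (Fin (t + 1) → k) ≃ₗ[k] (Fin (t + 1) → k))
  (c : Projectivization k (Fin (t + 1) → k))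

/-- The graded `R`-module `M` has a homogeneous basis `m 0, m 1, …` in the degrees `s, s + 1, …`,
on which a linear form `u` that vanishes at `c` acts by `u • m n = u (y n) m (n + 1)`. The vector
`y n` matters only modulo `c` and up to a scalar. -/
structure IsString {g : (Fin (t + 1) → k) ≃ₗ[k] (Fin (t + 1) → k)}
    {c : Projectivization k (Fin (t + 1) → k)} (M : GrMod.{u, v, u} (degR g c)) (s : ℤ)
    (y : ℕ → Fin (t + 1) → k) (m : ℕ → M.carrier) : Prop where
  ne_zero : ∀ n, m n ≠ 0
  deg_eq : ∀ n : ℕ, M.deg (s + n) = Submodule.span k {m n}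
  deg_bot : ∀ j < s, M.deg j = ⊥
  gen_smul : ∀ n (u : formsAt c),
    gen g c u • m n = (u : Module.Dual k (Fin (t + 1) → k)) (y n) • m (n + 1)

/-- Linear forms at `c` that take the value `1` at those `y n` that are not multiples of `c`. -/
theorem exists_formsAt (c : Projectivization k (Fin (t + 1) → k)) (y : ℕ → Fin (t + 1) → k) :
    ∃ u : ℕ → formsAt c, ∀ n, y n ∉ Submodule.span k {c.rep} →
      (u n : Module.Dual k (Fin (t + 1) → k)) (y n) = 1 := by
  have : ∀ n, ∃ u : formsAt c, y n ∉ Submodule.span k {c.rep} →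
      (u : Module.Dual k (Fin (t + 1) → k)) (y n) = 1 := by
    intro n
    by_cases hy : y n ∈ Submodule.span k {c.rep}
    · exact ⟨0, fun h => (h hy).elim⟩
    · obtain ⟨u, h0, h1⟩ := exists_dual_single hy
      exact ⟨⟨u, h0⟩, fun _ => h1⟩
  choose u hu using this
  exact ⟨u, hu⟩

namespace IsString

variable {g c} {M : GrMod.{u, v, u} (degR g c)} {N : GrMod.{u, v', u} (degR g c)} {s s' : ℤ}
  {y y' : ℕ → Fin (t + 1) → k} {m : ℕ → M.carrier} {m' : ℕ → N.carrier}

theorem mem_deg (h : IsString M s y m) (n : ℕ) : m n ∈ M.deg (s + n) := by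
  rw [h.deg_eq]
  exact Submodule.mem_span_singleton_self _

theorem mem_deg_zero (h : IsString M s y m) : m 0 ∈ M.deg s := by
  simpa using h.mem_deg 0

theorem word_smul (h : IsString M s y m) (u : ℕ → formsAt c) (n : ℕ) :
    word g c u n • m 0 =
      (∏ j ∈ Finset.range n, (u j : Module.Dual k (Fin (t + 1) → k)) (y j)) • m n := by
  induction n with
  | zero => simp [word]
  | succ n ih =>
    rw [word, mul_smul, ih, smul_comm, h.gen_smul, smul_smul, Finset.prod_range_succ]

/-- If no `y n` is a multiple of `c`, then some linear form maps `m n` to `m (n + 1)` for every `n`,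
and the module is generated by `m 0`. -/
theorem span_eq_top (h : IsString M s y m) (hy : ∀ n, y n ∉ Submodule.span k {c.rep}) :
    Submodule.span (subalgR g c) {m 0} = ⊤ := by
  obtain ⟨u, hu⟩ := exists_formsAt c y
  rw [eq_top_iff]
  have h1 : ⨆ n, M.deg n ≤ (Submodule.span (subalgR g c) {m 0}).restrictScalars k := by
    refine iSup_le fun j => ?_
    rcases lt_or_ge j s with hj | hj
    · rw [h.deg_bot j hj]
      exact bot_le
    · obtain ⟨n, rfl⟩ := Int.le.dest hj
      rw [h.deg_eq, Submodule.span_singleton_le_iff_mem]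
      refine Submodule.mem_span_singleton.2 ⟨word g c u n, ?_⟩
      rw [h.word_smul, Finset.prod_eq_one fun j _ => hu j (hy j), one_smul]
  intro x _
  have hx : x ∈ ⨆ n, M.deg n := by
    rw [M.isInternal.submodule_iSup_eq_top]
    trivial
  exact h1 hx

theorem isPointModule (h : IsString M 0 y m) (hy : ∀ n, y n ∉ Submodule.span k {c.rep}) :
    M.IsPointModule := by
  refine ⟨⟨m 0, h.mem_deg_zero, h.span_eq_top hy⟩, fun n => ?_⟩
  have := h.deg_eq n
  rw [zero_add] at this
  rw [this]
  exact finrank_span_singleton (h.ne_zero n)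

theorem mem_pointIdeal_iff (h : IsString M 0 y m) (a : subalgR g c) :
    a ∈ M.pointIdeal ↔ a • m 0 = 0 := by
  constructor
  · intro ha
    exact ha _ h.mem_deg_zero
  · intro ha x hx
    have h1 := h.deg_eq 0
    rw [Nat.cast_zero, zero_add] at h1
    rw [h1] at hx
    obtain ⟨r, rfl⟩ := Submodule.mem_span_singleton.1 hx
    rw [smul_comm, ha, smul_zero]

/-- Strings with the same vectors `y n` up to scalars and modulo `c`, for `n < N₀`, have generators
that are annihilated by the same elements of `R_n`, for `n ≤ N₀`. -/
theorem smul_eq_zero_iff (h : IsString M s y m) (h' : IsString N s' y' m') {N₀ : ℕ}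
    (hyy : ∀ n < N₀, SameModulo (K := k) c.rep (y' n) (y n)) {n : ℕ} (hn : n ≤ N₀)
    {a : subalgR g c} (ha : a ∈ degR g c n) : a • m 0 = 0 ↔ a • m' 0 = 0 := by
  have hr : ∀ n, ∃ r : k, r ≠ 0 ∧ (n < N₀ → y' n - r • y n ∈ Submodule.span k {c.rep}) := by
    intro n
    by_cases hn : n < N₀
    · obtain ⟨r, hr, hr'⟩ := hyy n hn
      exact ⟨r, hr, fun _ => hr'⟩
    · exact ⟨1, one_ne_zero, fun h => (hn h).elim⟩
  choose r hr hr' using hr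
  have key : n ≤ N₀ → ∃ q : k, a • m 0 = q • m n ∧
      a • m' 0 = (q * ∏ j ∈ Finset.range n, r j) • m' n := by
    refine degR_induction g c (P := fun n a => n ≤ N₀ → ∃ q : k, a • m 0 = q • m n ∧
      a • m' 0 = (q * ∏ j ∈ Finset.range n, r j) • m' n) ?_ ?_ ?_ ?_ ?_ ha
    · intro n _
      exact ⟨0, by simp, by simp⟩
    · intro n a b iha ihb hn
      obtain ⟨q, h1, h2⟩ := iha hn
      obtain ⟨q', h1', h2'⟩ := ihb hn
      exact ⟨q + q', by rw [add_smul, h1, h1', add_smul],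
        by rw [add_smul, h2, h2', add_mul, add_smul]⟩
    · intro n p a ih hn
      obtain ⟨q, h1, h2⟩ := ih hn
      exact ⟨p * q, by rw [smul_assoc, h1, smul_smul], by rw [smul_assoc, h2, smul_smul, mul_assoc]⟩
    · intro _
      exact ⟨1, by simp, by simp⟩
    · intro n u a _ ih hn
      obtain ⟨q, h1, h2⟩ := ih (by omega)
      refine ⟨q * (u : Module.Dual k (Fin (t + 1) → k)) (y n), ?_, ?_⟩
      · rw [mul_smul, h1, smul_comm, h.gen_smul, smul_smul]
      · obtain ⟨z, hz⟩ := Submodule.mem_span_singleton.1 (hr' n hn)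
        have hu : (u : Module.Dual k (Fin (t + 1) → k)) (y' n) =
            r n * (u : Module.Dual k (Fin (t + 1) → k)) (y n) := by
          have h3 := congrArg (u : Module.Dual k (Fin (t + 1) → k)) hz
          rw [map_smul, mem_formsAt.1 u.2, smul_zero, map_sub, map_smul, smul_eq_mul] at h3
          exact (sub_eq_zero.1 h3.symm)
        rw [mul_smul, h2, smul_comm, h'.gen_smul, smul_smul, hu, Finset.prod_range_succ]
        congr 1
        ring
  -- the coefficients in the two modules differ by the nonzero factor `∏ r j`
  obtain ⟨q, h1, h2⟩ := key hn
  rw [h1, h2, smul_eq_zero_iff_left (h.ne_zero n), smul_eq_zero_iff_left (h'.ne_zero n),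
    mul_eq_zero, or_iff_left (Finset.prod_ne_zero_iff.2 fun j _ => hr j)]

theorem isom (h : IsString M s y m) (h' : IsString N s y' m')
    (hy : ∀ n, y n ∉ Submodule.span k {c.rep}) (hy' : ∀ n, y' n ∉ Submodule.span k {c.rep})
    (hyy : ∀ n, SameModulo (K := k) c.rep (y' n) (y n)) : M.Isom N :=
  GrMod.isom_of_cyclic h.mem_deg_zero h'.mem_deg_zero (h.span_eq_top hy) (h'.span_eq_top hy')
    fun _ _ ha => h.smul_eq_zero_iff h' (fun n _ => hyy n) le_rfl ha

/-- The lines spanned by `c` and `y n` are determined by the isomorphism class of the module. -/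
theorem sameModulo_of_isom (h : IsString M 0 y m) (h' : IsString N 0 y' m')
    (hy : ∀ n, y n ∉ Submodule.span k {c.rep}) (hy' : ∀ n, y' n ∉ Submodule.span k {c.rep})
    (hMN : M.Isom N) (n : ℕ) : SameModulo (K := k) c.rep (y' n) (y n) := by
  have hann : ∀ a, a • m 0 = 0 ↔ a • m' 0 = 0 := fun a => by
    rw [← h.mem_pointIdeal_iff, ← h'.mem_pointIdeal_iff, hMN.pointIdeal_eq]
  obtain ⟨u, hu⟩ := exists_formsAt c y
  have h1 : word g c u n • m 0 = m n := by
    rw [h.word_smul, Finset.prod_eq_one fun j _ => hu j (hy j), one_smul]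
  have h2 := h'.word_smul u n
  set q := ∏ j ∈ Finset.range n, (u j : Module.Dual k (Fin (t + 1) → k)) (y' j)
  have hq : q ≠ 0 := by
    intro hq
    rw [hq, zero_smul, ← hann, h1] at h2
    exact h.ne_zero n h2
  refine sameModulo_of_mem_span_pair (mem_span_pair_of_dual fun w hw hwc => ?_) (hy' n)
  -- `word g c u n` maps `m 0` to `m n`, so multiplying it by `w` tests whether `w (y n) = 0`
  have h3 := hann (gen g c ⟨w, hwc⟩ * word g c u n)
  rw [mul_smul, mul_smul, h1, h2, smul_comm, h.gen_smul, h'.gen_smul, smul_smul,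
    smul_eq_zero_iff_left (h.ne_zero _), smul_eq_zero_iff_left (h'.ne_zero _), mul_eq_zero,
    or_iff_right hq] at h3
  exact h3.1 hw

theorem shift (h : IsString M s y m) : IsString (M.shift s) 0 y m where
  ne_zero := h.ne_zero
  deg_eq n := by
    change M.deg (s + (0 + n)) = _
    rw [zero_add]
    exact h.deg_eq n
  deg_bot j hj := h.deg_bot (s + j) (by omega)
  gen_smul := h.gen_smul

/-- The tail of a string starting `r` degrees later is the string with the first `r` vectors
removed. -/
theorem tail (h : IsString M s y m) (r : ℕ) {s₁ : ℤ} (hs : s₁ = s + r) :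
    IsString (M.tail s₁) s₁ (fun n => y (r + n))
      (fun n => ⟨m (r + n), M.mem_tailSub (by push_cast; omega) (h.mem_deg (r + n))⟩) where
  ne_zero n h0 := h.ne_zero (r + n) (congrArg Subtype.val h0)
  deg_eq n := by
    have h1 : M.deg (s₁ + n) = Submodule.span k {m (r + n)} := by
      rw [← h.deg_eq, hs, add_assoc]
      push_cast
      rfl
    refine Submodule.ext fun (x : M.tailSub s₁) => ?_
    change (x : M.carrier) ∈ M.deg (s₁ + n) ↔ _
    rw [h1, Submodule.mem_span_singleton]
    constructor
    · rintro ⟨q, hq⟩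
      exact Submodule.mem_span_singleton.2 ⟨q, Subtype.ext hq⟩
    · intro hx
      obtain ⟨q, hq⟩ := Submodule.mem_span_singleton.1 hx
      exact ⟨q, congrArg Subtype.val hq⟩
  deg_bot j hj := by
    rw [eq_bot_iff]
    intro (x : M.tailSub s₁) hx
    exact Subtype.ext (M.eq_zero_of_mem_tailSub hj hx x.2)
  gen_smul n u := Subtype.ext (h.gen_smul (r + n) u)

theorem trunc_span_eq_top (h : IsString M 0 y m) {i : ℕ}
    (hy : ∀ n < i, y n ∉ Submodule.span k {c.rep}) :
    Submodule.span (subalgR g c) {(M.tailSub (i + 1)).mkQ (m 0)} = ⊤ := by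
  obtain ⟨u, hu⟩ := exists_formsAt c y
  rw [eq_top_iff]
  have h1 : ⨆ n, M.deg n ≤ ((Submodule.span (subalgR g c)
      {(M.tailSub (i + 1)).mkQ (m 0)}).comap (M.tailSub (i + 1)).mkQ).restrictScalars k := by
    refine iSup_le fun j => ?_
    rcases lt_or_ge j 0 with hj | hj
    · rw [h.deg_bot j hj]
      exact bot_le
    · rcases lt_or_ge (i : ℤ) j with hji | hji
      · intro x hx
        have hx' : (M.tailSub (i + 1)).mkQ x = 0 := by
          rw [← LinearMap.mem_ker, Submodule.ker_mkQ]
          exact M.mem_tailSub (by omega) hx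
        change (M.tailSub (i + 1)).mkQ x ∈
          Submodule.span (subalgR g c) {(M.tailSub (i + 1)).mkQ (m 0)}
        rw [hx']
        exact zero_mem _
      · obtain ⟨n, rfl⟩ := Int.le.dest hj
        rw [h.deg_eq, Submodule.span_singleton_le_iff_mem]
        refine Submodule.mem_span_singleton.2 ⟨word g c u n, ?_⟩
        rw [← map_smul, h.word_smul, Finset.prod_eq_one fun j hj => hu j (hy j ?_), one_smul]
        have := Finset.mem_range.1 hj
        omega
  rintro x -
  obtain ⟨x, rfl⟩ := (M.tailSub (i + 1)).mkQ_surjective x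
  have hx : x ∈ ⨆ n, M.deg n := by
    rw [M.isInternal.submodule_iSup_eq_top]
    trivial
  exact h1 hx

/-- Truncations of strings that agree up to degree `i` are isomorphic. -/
theorem trunc_isom (h : IsString M 0 y m) (h' : IsString N 0 y' m') {i : ℕ}
    (hy : ∀ n < i, y n ∉ Submodule.span k {c.rep})
    (hyy : ∀ n < i, y' n = y n) : (M.trunc i).Isom (N.trunc i) := by
  refine GrMod.isom_of_cyclic (s := 0) ⟨m 0, h.mem_deg_zero, rfl⟩ ⟨m' 0, h'.mem_deg_zero, rfl⟩
    (h.trunc_span_eq_top hy) (h'.trunc_span_eq_top fun n hn => by rw [hyy n hn]; exact hy n hn)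
    fun n a _ => ?_
  change a • (M.tailSub (i + 1)).mkQ (m 0) = 0 ↔ a • (N.tailSub (i + 1)).mkQ (m' 0) = 0
  rw [← map_smul, ← map_smul, ← LinearMap.mem_ker, ← LinearMap.mem_ker, Submodule.ker_mkQ,
    Submodule.ker_mkQ, M.smul_mem_tailSub_iff h.mem_deg_zero,
    N.smul_mem_tailSub_iff h'.mem_deg_zero]
  refine forall_congr' fun j => imp_congr_right fun hj => ?_
  refine h.smul_eq_zero_iff h' (N₀ := i) (fun n hn => ?_) (by omega) (SetLike.coe_mem _)
  rw [hyy n hn]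
  exact SameModulo.refl _ _

end IsString

/-- Every point module is a string, and none of the lines spanned by `c` and `y n` degenerates. -/
theorem GrMod.IsPointModule.exists_isString {g : (Fin (t + 1) → k) ≃ₗ[k] (Fin (t + 1) → k)}
    {c : Projectivization k (Fin (t + 1) → k)} {M : GrMod.{u, v, u} (degR g c)}
    (hM : M.IsPointModule) : ∃ y m, IsString M 0 y m ∧ ∀ n, y n ∉ Submodule.span k {c.rep} := by
  obtain ⟨⟨x, hx, hspan⟩, hdim⟩ := hM
  have hm : ∀ n : ℕ, ∃ m : M.carrier, m ≠ 0 ∧ M.deg n = Submodule.span k {m} := by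
    intro n
    obtain ⟨m, hm, hm'⟩ := finrank_eq_one_iff'.1 (hdim n)
    refine ⟨m, fun h0 => hm (Subtype.ext h0), le_antisymm ?_ ?_⟩
    · intro z hz
      obtain ⟨q, hq⟩ := hm' ⟨z, hz⟩
      exact Submodule.mem_span_singleton.2 ⟨q, congrArg Subtype.val hq⟩
    · rw [Submodule.span_singleton_le_iff_mem]
      exact m.2
  choose m hm0 hm using hm
  have hmem : ∀ n : ℕ, m n ∈ M.deg n := fun n => by
    rw [hm]
    exact Submodule.mem_span_singleton_self _
  have hy : ∀ n, ∃ y : Fin (t + 1) → k, ∀ u : formsAt c,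
      gen g c u • m n = (u : Module.Dual k (Fin (t + 1) → k)) y • m (n + 1) := by
    intro n
    have h1 : ∀ u : formsAt c, ∃ q : k, q • m (n + 1) = gen g c u • m n := by
      intro u
      have := M.smul_mem (gen_mem g c u) (hmem n)
      rw [← Nat.cast_add, hm] at this
      exact Submodule.mem_span_singleton.1 this
    choose q hq using h1
    let f : formsAt c →ₗ[k] k :=
      { toFun := q
        map_add' := fun u v => by
          apply smul_left_injective k (hm0 (n + 1))
          simp only [add_smul, hq, map_add]
        map_smul' := fun r u => by
          apply smul_left_injective k (hm0 (n + 1))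
          simp only [hq, map_smul, RingHom.id_apply, smul_eq_mul, mul_smul, smul_assoc] }
    obtain ⟨F, hF⟩ := LinearMap.exists_extend f
    refine ⟨(Module.evalEquiv k (Fin (t + 1) → k)).symm F, fun u => ?_⟩
    rw [Module.apply_evalEquiv_symm_apply, ← hq]
    exact congrArg (· • m (n + 1)) (congrArg (fun φ => φ u) hF).symm
  choose y hy using hy
  refine ⟨y, m, ⟨hm0, fun n => ?_, fun j hj => M.deg_eq_bot_of_lt hx hspan hj, hy⟩, ?_⟩
  · rw [zero_add]
    exact hm n
  · intro n hn
    -- otherwise `R_1` annihilates `M_n`, and `M_{n+1} = R_1 M_n` vanishes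
    obtain ⟨z, hz⟩ := Submodule.mem_span_singleton.1 hn
    have h0 : ∀ u : formsAt c, gen g c u • m n = 0 := by
      intro u
      rw [hy, ← hz, map_smul, mem_formsAt.1 u.2, smul_zero, zero_smul]
    have h1 : ∀ {j : ℕ} {a : subalgR g c}, a ∈ degR g c j → j = n + 1 → a • x = 0 := by
      intro j a ha
      refine degR_induction g c (P := fun j a => j = n + 1 → a • x = 0) ?_ ?_ ?_ ?_ ?_ ha
      · intro j _
        exact zero_smul _ _
      · intro j a b iha ihb hj
        rw [add_smul, iha hj, ihb hj, add_zero]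
      · intro j r a ih hj
        rw [smul_assoc, ih hj, smul_zero]
      · intro hj
        omega
      · intro j u a ha _ hj
        obtain rfl : j = n := by omega
        have h2 := M.smul_mem ha hx
        rw [zero_add, hm] at h2
        obtain ⟨q, hq⟩ := Submodule.mem_span_singleton.1 h2
        rw [mul_smul, ← hq, smul_comm, h0, smul_zero]
    obtain ⟨a, ha, hax⟩ := M.exists_smul_of_mem_deg hx hspan (n + 1)
      (z := m (n + 1)) (by rw [zero_add]; exact hmem (n + 1))
    exact hm0 (n + 1) (hax.trans (h1 ha rfl))

end Strings

/-! ### The ideal of a point and its square -/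

section PointIdeals

variable {k : Type u} [Field k] {t : ℕ} {d : Projectivization k (Fin (t + 1) → k)}

theorem eval_eq_zero_of_mem {f : MvPolynomial (Fin (t + 1)) k} (hf : f ∈ vanishingIdeal d) :
    eval d.rep f = 0 := by
  have h : vanishingIdeal d ≤ RingHom.ker (eval d.rep) := Ideal.span_le.2 fun f hf => hf.2
  exact h hf

theorem mem_vanishingIdeal_iff {f : MvPolynomial (Fin (t + 1)) k} {n : ℕ}
    (hf : f.IsHomogeneous n) : f ∈ vanishingIdeal d ↔ eval d.rep f = 0 :=
  ⟨eval_eq_zero_of_mem, fun h => Ideal.subset_span ⟨⟨n, hf⟩, h⟩⟩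

/-- The derivative of polynomials at the point `p` in the direction `x`. -/
noncomputable def dirDeriv (p x : Fin (t + 1) → k) : MvPolynomial (Fin (t + 1)) k →ₗ[k] k :=
  ∑ i, x i • ((aeval p).toLinearMap ∘ₗ (pderiv i : Derivation k _ _).toLinearMap)

theorem dirDeriv_apply (p x : Fin (t + 1) → k) (f : MvPolynomial (Fin (t + 1)) k) :
    dirDeriv p x f = ∑ i, x i * eval p (pderiv i f) := by
  simp [dirDeriv, aeval_eq_eval]

theorem dirDeriv_mul (p x : Fin (t + 1) → k) (f h : MvPolynomial (Fin (t + 1)) k) :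
    dirDeriv p x (f * h) = eval p f * dirDeriv p x h + dirDeriv p x f * eval p h := by
  simp only [dirDeriv_apply, Derivation.leibniz, map_add, smul_eq_mul, map_mul, Finset.mul_sum,
    Finset.sum_mul, ← Finset.sum_add_distrib]
  exact Finset.sum_congr rfl fun i _ => by ring

theorem dirDeriv_linForm (p x : Fin (t + 1) → k) (w : Module.Dual k (Fin (t + 1) → k)) :
    dirDeriv p x (linForm w) = w x := by
  rw [dirDeriv_apply, dual_apply_eq_sum, linForm_apply]
  refine Finset.sum_congr rfl fun i _ => ?_
  simp [pderiv_X, Pi.single_apply, mul_comm]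

theorem dirDeriv_add_direction (p x y : Fin (t + 1) → k) (f : MvPolynomial (Fin (t + 1)) k) :
    dirDeriv p (x + y) f = dirDeriv p x f + dirDeriv p y f := by
  simp [dirDeriv_apply, add_mul, Finset.sum_add_distrib]

theorem dirDeriv_smul_direction (p : Fin (t + 1) → k) (r : k) (x : Fin (t + 1) → k)
    (f : MvPolynomial (Fin (t + 1)) k) : dirDeriv p (r • x) f = r * dirDeriv p x f := by
  simp [dirDeriv_apply, Finset.mul_sum, mul_assoc]

theorem dirDeriv_self (p : Fin (t + 1) → k) {f : MvPolynomial (Fin (t + 1)) k} {n : ℕ}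
    (hf : f.IsHomogeneous n) : dirDeriv p p f = n * eval p f := by
  have := congrArg (eval p) hf.sum_X_mul_pderiv
  simpa [dirDeriv_apply] using this

theorem dirDeriv_eq_zero_of_mem_sq (x : Fin (t + 1) → k) {f : MvPolynomial (Fin (t + 1)) k}
    (hf : f ∈ vanishingIdeal d ^ 2) : dirDeriv d.rep x f = 0 := by
  rw [pow_two] at hf
  induction hf using Submodule.mul_induction_on' with
  | mem_mul_mem a ha b hb =>
    rw [dirDeriv_mul, eval_eq_zero_of_mem ha, eval_eq_zero_of_mem hb, zero_mul, mul_zero, add_zero]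
  | add a _ b _ iha ihb => rw [map_add, iha, ihb, add_zero]

theorem eval_eq_zero_of_mem_sq {f : MvPolynomial (Fin (t + 1)) k}
    (hf : f ∈ vanishingIdeal d ^ 2) : eval d.rep f = 0 :=
  eval_eq_zero_of_mem (Ideal.pow_le_self two_ne_zero hf)

theorem aeval_C_mul_of_isHomogeneous (p : Fin (t + 1) → k) (z : MvPolynomial (Fin (t + 1)) k)
    {f : MvPolynomial (Fin (t + 1)) k} {n : ℕ} (hf : f.IsHomogeneous n) :
    aeval (fun i => C (p i) * z) f = C (eval p f) * z ^ n := by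
  rw [aeval_def, eval₂_eq, eval_eq, map_sum, Finset.sum_mul]
  refine Finset.sum_congr rfl fun e he => ?_
  have hdeg : ∑ i ∈ e.support, e i = n := by
    have := hf (mem_support_iff.1 he)
    simpa [Finsupp.weight_apply, Finsupp.sum] using this
  simp only [mul_pow, Finset.prod_mul_distrib, Finset.prod_pow_eq_pow_sum, hdeg, algebraMap_eq,
    map_mul, map_prod, map_pow, mul_assoc]

/-- The Taylor expansion to first order of `f` in the elements `X i - C (p i) * z` of an ideal. -/
theorem sub_taylor_mem_sq (p : Fin (t + 1) → k) (z : MvPolynomial (Fin (t + 1)) k)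
    (I : Ideal (MvPolynomial (Fin (t + 1)) k)) (hI : ∀ i, X i - C (p i) * z ∈ I)
    (f : MvPolynomial (Fin (t + 1)) k) :
    f - aeval (fun i => C (p i) * z) f -
      ∑ j, aeval (fun i => C (p i) * z) (pderiv j f) * (X j - C (p j) * z) ∈ I ^ 2 := by
  induction f using MvPolynomial.induction_on with
  | C a => simp [algebraMap_eq]
  | add f h hf hh =>
    convert add_mem hf hh using 1
    simp only [map_add, add_mul, Finset.sum_add_distrib]
    ring
  | mul_X f i hf =>
    set ψ := aeval (R := k) (fun i => C (p i) * z) with hψ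
    have hψX : ψ (X i) = C (p i) * z := by simp [hψ]
    have hsum : ∑ j, ψ (pderiv j (f * X i)) * (X j - C (p j) * z) =
        (∑ j, ψ (pderiv j f) * (X j - C (p j) * z)) * (C (p i) * z) +
          ψ f * (X i - C (p i) * z) := by
      rw [Finset.sum_mul]
      have h1 : ψ f * (X i - C (p i) * z) =
          ∑ j, if j = i then ψ f * (X j - C (p j) * z) else 0 := by simp
      rw [h1, ← Finset.sum_add_distrib]
      refine Finset.sum_congr rfl fun j _ => ?_
      rw [Derivation.leibniz, pderiv_X, smul_eq_mul, smul_eq_mul, map_add, map_mul, map_mul, hψX]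
      by_cases hji : j = i
      · subst hji
        simp
        ring
      · simp [hji]
        ring
    have hsq : (∑ j, ψ (pderiv j f) * (X j - C (p j) * z)) * (X i - C (p i) * z) ∈ I ^ 2 := by
      rw [pow_two]
      exact Ideal.mul_mem_mul (Ideal.sum_mem _ fun j _ => Ideal.mul_mem_left _ _ (hI j)) (hI i)
    rw [hsum, map_mul, hψX]
    convert add_mem (Ideal.mul_mem_right (X i) _ hf) hsq using 1
    ring

/-- A homogeneous polynomial lies in `𝔪_d²` if it vanishes at `d` together with its derivatives. -/
theorem mem_sq_of_dirDeriv_eq_zero {f : MvPolynomial (Fin (t + 1)) k} {n : ℕ}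
    (hf : f.IsHomogeneous n) (h0 : eval d.rep f = 0) (h1 : ∀ x, dirDeriv d.rep x f = 0) :
    f ∈ vanishingIdeal d ^ 2 := by
  obtain ⟨w, -, hw⟩ := exists_dual_single (K := k) (a := 0) (y := d.rep) (by
    simpa using d.rep_nonzero)
  have hI : ∀ i, X i - C (d.rep i) * linForm w ∈ vanishingIdeal d := by
    intro i
    refine (mem_vanishingIdeal_iff (n := 1) ?_).2 (by simp [hw])
    refine (homogeneousSubmodule (Fin (t + 1)) k 1).sub_mem (isHomogeneous_X _ _) ?_
    simpa using (isHomogeneous_C (Fin (t + 1)) (d.rep i)).mul (linForm_isHomogeneous w)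
  have h2 := sub_taylor_mem_sq d.rep (linForm w) _ hI f
  have h3 : ∀ j, eval d.rep (pderiv j f) = 0 := by
    intro j
    have := h1 (Pi.single j 1)
    rw [dirDeriv_apply, Finset.sum_eq_single j] at this
    · simpa using this
    · intro i _ hi
      simp [hi]
    · simp
  rw [aeval_C_mul_of_isHomogeneous _ _ hf, h0] at h2
  simp only [aeval_C_mul_of_isHomogeneous _ _ hf.pderiv, h3] at h2
  simpa using h2

end PointIdeals

/-! ### The point modules of the Zhang twist as strings -/

section Strings

variable {k : Type u} [Field k] {t : ℕ} {g : (Fin (t + 1) → k) ≃ₗ[k] (Fin (t + 1) → k)}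
  {c : Projectivization k (Fin (t + 1) → k)}

theorem exists_dual_rep_eq_one (d : Projectivization k (Fin (t + 1) → k)) :
    ∃ w : Module.Dual k (Fin (t + 1) → k), w d.rep = 1 := by
  obtain ⟨w, -, hw⟩ := exists_dual_single (K := k) (a := 0) (y := d.rep) (by
    simpa using d.rep_nonzero)
  exact ⟨w, hw⟩

/-- `P(d)` is a string over `R`, on which a linear form `u` acts in degree `n` by its value at
`φⁿ(d)`; the basis consists of the powers of a linear form that does not vanish at `d`. -/
theorem exists_isString_pointModuleR (d : Projectivization k (Fin (t + 1) → k)) :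
    ∃ m : ℕ → (pointModuleR g c d).carrier,
      IsString (pointModuleR g c d) 0 (fun n => (g ^ n) d.rep) m ∧
      ∀ a : subalgR g c, a • m 0 = 0 ↔ a ∈ interIdeal g c d := by
  obtain ⟨w, hw⟩ := exists_dual_rep_eq_one d
  let I := twistIdeal g (vanishingIdeal d) (vanishingIdeal_isHomogeneous d)
  let b : ℕ → ZhangTwist g := fun n => (toPoly g).symm (linForm w ^ n)
  have hb : ∀ n, b n ∈ twistDeg g n := fun n => by
    have := (linForm_isHomogeneous w).pow n
    rwa [one_mul] at this
  have hbe : ∀ n, eval d.rep (toPoly g (b n)) = 1 := fun n => by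
    rw [LinearEquiv.apply_symm_apply, map_pow, eval_linForm, hw, one_pow]
  have hmk : ∀ {n : ℕ} {f h : ZhangTwist g}, f ∈ twistDeg g n → h ∈ twistDeg g n →
      eval d.rep (toPoly g f) = eval d.rep (toPoly g h) → I.mkQ f = I.mkQ h := by
    intro n f h hf hh he
    refine (Submodule.Quotient.eq I).2 ?_
    refine (mem_vanishingIdeal_iff (n := n) (Submodule.sub_mem _ hf hh)).2 ?_
    change eval d.rep (toPoly g f - toPoly g h) = 0
    rw [map_sub, he, sub_self]
  refine ⟨fun n => I.mkQ (b n), ⟨?_, ?_, ?_, ?_⟩, ?_⟩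
  · intro n h0
    have h1 : b n ∈ I := (Submodule.Quotient.mk_eq_zero I).1 h0
    exact one_ne_zero ((hbe n).symm.trans (eval_eq_zero_of_mem h1))
  · intro n
    rw [zero_add]
    change Submodule.map (I.mkQ.restrictScalars k) (twistDeg g n) =
      Submodule.span k {I.mkQ (b n)}
    apply le_antisymm
    · rintro _ ⟨f, hf, rfl⟩
      refine Submodule.mem_span_singleton.2 ⟨eval d.rep (toPoly g f), ?_⟩
      refine Eq.trans (?_ : _ = I.mkQ (eval d.rep (toPoly g f) • b n)) (hmk (n := n)
        (Submodule.smul_mem _ _ (hb n)) hf ?_)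
      · rfl
      · rw [map_smul, smul_eval, hbe, mul_one]
    · rw [Submodule.span_singleton_le_iff_mem]
      exact ⟨b n, hb n, rfl⟩
  · intro j hj
    obtain ⟨n, rfl⟩ := Int.eq_negSucc_of_lt_zero hj
    exact Submodule.map_bot (I.mkQ.restrictScalars k)
  · intro n u
    have h1 : (gen g c u : ZhangTwist g) * b n ∈ twistDeg g (n + 1) := by
      rw [add_comm]
      exact SetLike.mul_mem_graded (gen_mem g c u) (hb n)
    refine hmk (n := n + 1) (f := (gen g c u : ZhangTwist g) * b n)
      (h := (u : Module.Dual k (Fin (t + 1) → k)) ((g ^ n) d.rep) • b (n + 1)) h1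
      (Submodule.smul_mem _ _ (hb _)) ?_
    rw [toPoly_mul_of_mem g _ (hb n), map_mul, hbe, mul_one, map_smul, smul_eval, hbe, mul_one,
      toPoly_gen, subst_pow_linForm, eval_linForm]
    rfl
  · intro a
    have hb0 : b 0 = 1 := rfl
    change I.mkQ ((a : ZhangTwist g) * b 0) = 0 ↔ _
    rw [hb0, mul_one]
    exact Submodule.Quotient.mk_eq_zero I

end Strings

/-! ### The lines of a string are compatible -/

section Strings

variable {k : Type u} [Field k] {t : ℕ} {g : (Fin (t + 1) → k) ≃ₗ[k] (Fin (t + 1) → k)}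
  {c : Projectivization k (Fin (t + 1) → k)}

theorem symm_pow_rep (g : (Fin (t + 1) → k) ≃ₗ[k] (Fin (t + 1) → k))
    (c : Projectivization k (Fin (t + 1) → k)) (n : ℕ) :
    (g ^ n).symm c.rep = orbitVec g c n := by
  rw [LinearEquiv.symm_apply_eq, pow_orbitVec_self]

theorem symm_pow_mem_span_iff (n : ℕ) (y : Fin (t + 1) → k) :
    (g ^ n).symm y ∈ Submodule.span k {orbitVec g c n} ↔ y ∈ Submodule.span k {c.rep} := by
  rw [← pow_mem_span_rep_iff, LinearEquiv.apply_symm_apply]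

/-- Linear forms `w n` that vanish at the points `c_n` are the factors, in the polynomial ring, of
a product in `R` of linear forms that vanish at `c`. -/
theorem exists_formsAt_comp {w : ℕ → Module.Dual k (Fin (t + 1) → k)}
    (hw : ∀ n : ℕ, w n (orbitVec g c n) = 0) : ∃ u : ℕ → formsAt c,
      (∀ n x, (u n : Module.Dual k (Fin (t + 1) → k)) x = w n ((g ^ n).symm x)) ∧
      ∀ n, toPoly g (word g c u n : ZhangTwist g) = ∏ j ∈ Finset.range n, linForm (w j) := by
  refine ⟨fun n => ⟨w n ∘ₗ (g ^ n).symm.toLinearMap, ?_⟩, fun n x => rfl, fun n => ?_⟩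
  · refine mem_formsAt.2 ?_
    change w n ((g ^ n).symm c.rep) = 0
    rw [symm_pow_rep, hw]
  · rw [toPoly_word]
    refine Finset.prod_congr rfl fun j _ => congrArg linForm (LinearMap.ext fun x => ?_)
    change w j ((g ^ j).symm ((g ^ j) x)) = w j x
    rw [LinearEquiv.symm_apply_apply]

/-- Functionals dual to vectors `x n` that are not proportional to the `c_n`. -/
theorem exists_dual_family {x : ℕ → Fin (t + 1) → k}
    (hx : ∀ n : ℕ, x n ∉ Submodule.span k {orbitVec g c n}) :
    ∃ w : ℕ → Module.Dual k (Fin (t + 1) → k),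
      (∀ n : ℕ, w n (orbitVec g c n) = 0) ∧ ∀ n, w n (x n) = 1 := by
  choose w hw hw' using fun n => exists_dual_single (hx n)
  exact ⟨w, hw, hw'⟩

theorem IsString.prod_eq_of_prod_linForm_eq {M : GrMod.{u, v, u} (degR g c)}
    {y : ℕ → Fin (t + 1) → k} {m : ℕ → M.carrier} (h : IsString M 0 y m)
    {w w' : ℕ → Module.Dual k (Fin (t + 1) → k)} (hw : ∀ n : ℕ, w n (orbitVec g c n) = 0)
    (hw' : ∀ n : ℕ, w' n (orbitVec g c n) = 0) {N : ℕ}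
    (he : ∏ j ∈ Finset.range N, linForm (w j) = ∏ j ∈ Finset.range N, linForm (w' j)) :
    ∏ j ∈ Finset.range N, w j ((g ^ j).symm (y j)) =
      ∏ j ∈ Finset.range N, w' j ((g ^ j).symm (y j)) := by
  obtain ⟨u, hu, hword⟩ := exists_formsAt_comp hw
  obtain ⟨u', hu', hword'⟩ := exists_formsAt_comp hw'
  have h1 : word g c u N = word g c u' N :=
    Subtype.ext ((toPoly g).injective (by rw [hword, hword', he]))
  have h2 := h.word_smul u N
  rw [h1, h.word_smul u' N] at h2
  have h3 := smul_left_injective k (h.ne_zero N) h2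
  simp only [hu, hu'] at h3
  exact h3.symm

theorem prod_range_eq_mul_three {R : Type*} [CommMonoid R] {i j l N : ℕ} (hij : i ≠ j)
    (hil : i ≠ l) (hjl : j ≠ l) (hi : i < N) (hj : j < N) (hl : l < N) (F : ℕ → R) :
    ∏ n ∈ Finset.range N, F n =
      (∏ n ∈ Finset.range N \ {i, j, l}, F n) * (F i * F j * F l) := by
  rw [← Finset.prod_sdiff (s₁ := {i, j, l}) (s₂ := Finset.range N)]
  · rw [Finset.prod_insert (by simp [hij, hil]), Finset.prod_insert (by simp [hjl]),
      Finset.prod_singleton, mul_assoc (F i)]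
  · intro n hn
    simp only [Finset.mem_insert, Finset.mem_singleton] at hn
    rcases hn with rfl | rfl | rfl <;> simpa

/-- Equal products of three linear forms, that vanish at `c_i`, `c_j` and `c_l`, have equal products
of values. -/
theorem IsString.prod_three {M : GrMod.{u, v, u} (degR g c)}
    {y : ℕ → Fin (t + 1) → k} {m : ℕ → M.carrier} (h : IsString M 0 y m)
    (hy : ∀ n, y n ∉ Submodule.span k {c.rep}) {i j l : ℕ} (hij : i ≠ j) (hil : i ≠ l)
    (hjl : j ≠ l) {a b d a' b' d' : Module.Dual k (Fin (t + 1) → k)}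
    (ha : a (orbitVec g c i) = 0) (hb : b (orbitVec g c j) = 0) (hd : d (orbitVec g c l) = 0)
    (ha' : a' (orbitVec g c i) = 0) (hb' : b' (orbitVec g c j) = 0)
    (hd' : d' (orbitVec g c l) = 0)
    (he : linForm a * linForm b * linForm d = linForm a' * linForm b' * linForm d') :
    a ((g ^ i).symm (y i)) * b ((g ^ j).symm (y j)) * d ((g ^ l).symm (y l)) =
      a' ((g ^ i).symm (y i)) * b' ((g ^ j).symm (y j)) * d' ((g ^ l).symm (y l)) := by
  obtain ⟨w₀, hw₀, hw₀'⟩ := exists_dual_family (g := g) (c := c)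
    (x := fun n => (g ^ n).symm (y n)) fun n => by
      rw [symm_pow_mem_span_iff]
      exact hy n
  let W : Module.Dual k (Fin (t + 1) → k) → Module.Dual k (Fin (t + 1) → k) →
      Module.Dual k (Fin (t + 1) → k) → ℕ → Module.Dual k (Fin (t + 1) → k) :=
    fun a b d n => if n = i then a else if n = j then b else if n = l then d else w₀ n
  have hW : ∀ a b d, a (orbitVec g c i) = 0 → b (orbitVec g c j) = 0 →
      d (orbitVec g c l) = 0 → ∀ n : ℕ, W a b d n (orbitVec g c n) = 0 := by
    intro a b d ha hb hd n
    simp only [W]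
    split_ifs with h1 h2 h3
    · rw [h1, ha]
    · rw [h2, hb]
    · rw [h3, hd]
    · exact hw₀ n
  have hWi : ∀ a b d, W a b d i = a := fun a b d => by simp [W]
  have hWj : ∀ a b d, W a b d j = b := fun a b d => by simp [W, hij.symm]
  have hWl : ∀ a b d, W a b d l = d := fun a b d => by simp [W, hil.symm, hjl.symm]
  have hWn : ∀ a b d, ∀ n ∈ Finset.range (i + j + l + 1) \ {i, j, l}, W a b d n = w₀ n := by
    intro a b d n hn
    simp only [Finset.mem_sdiff, Finset.mem_insert, Finset.mem_singleton, not_or] at hn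
    simp [W, hn.2]
  have hprod : ∀ {R : Type u} [CommMonoid R]
      (F : ℕ → Module.Dual k (Fin (t + 1) → k) → R) (a b d),
      ∏ n ∈ Finset.range (i + j + l + 1), F n (W a b d n) =
        (∏ n ∈ Finset.range (i + j + l + 1) \ {i, j, l}, F n (w₀ n)) * (F i a * F j b * F l d) := by
    intro R _ F a b d
    rw [prod_range_eq_mul_three hij hil hjl (by omega) (by omega) (by omega), hWi, hWj, hWl]
    congr 1
    exact Finset.prod_congr rfl fun n hn => by rw [hWn _ _ _ n hn]
  have key := h.prod_eq_of_prod_linForm_eq (hW a b d ha hb hd) (hW a' b' d' ha' hb' hd')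
    (N := i + j + l + 1) (by
      rw [hprod (fun _ w => linForm w), hprod (fun _ w => linForm w), he])
  rw [hprod (fun n w => w ((g ^ n).symm (y n))), hprod (fun n w => w ((g ^ n).symm (y n))),
    Finset.prod_eq_one fun n _ => hw₀' n, one_mul, one_mul] at key
  exact key

/-- A string whose lines do not degenerate gives rise to a compatible family of lines through the
points `c_n`: the action of `R` only depends on products of linear forms as polynomials. -/
theorem IsString.compatibleLines {M : GrMod.{u, v, u} (degR g c)}
    {y : ℕ → Fin (t + 1) → k} {m : ℕ → M.carrier} (h : IsString M 0 y m)
    (hy : ∀ n, y n ∉ Submodule.span k {c.rep}) :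
    CompatibleLines (K := k) (fun n : ℕ => orbitVec g c n) fun n => (g ^ n).symm (y n) where
  notMem n := by
    rw [symm_pow_mem_span_iff]
    exact hy n
  swap i j hij u w hui huj hwi hwj := by
    have hl : i + j + 1 ≠ i ∧ i + j + 1 ≠ j := by omega
    obtain ⟨d, hd, hd'⟩ := exists_dual_single (K := k) (a := orbitVec g c (i + j + 1 : ℕ))
      (y := (g ^ (i + j + 1)).symm (y (i + j + 1))) (by
        rw [symm_pow_mem_span_iff]
        exact hy _)
    have := h.prod_three hy hij hl.1.symm hl.2.symm hui hwj hd hwi huj hd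
      (by rw [mul_comm (linForm u)])
    rwa [hd', mul_one, mul_one] at this
  rotate i j l hij hil hjl w₁ w₂ w₃ h1j h1l h2i h2l h3i h3j :=
    h.prod_three hy hij hil hjl h2i h3j h1l h3i h1j h2l (by ring)

end Strings

/-! ### Modules defined by characters -/

section Characters

variable {k : Type u} [Field k] {t : ℕ} {g : (Fin (t + 1) → k) ≃ₗ[k] (Fin (t + 1) → k)}
  {c : Projectivization k (Fin (t + 1) → k)}

/-- Functionals `L n`, of which only the restriction to `R_n` matters, that are compatible with
multiplication by linear forms: `L (n + 1) (u * a) = u (y n) L n a`. They arise from a string as the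
coefficients of its generator under `R_n`. -/
structure IsCharacter (y : ℕ → Fin (t + 1) → k) (L : ℕ → subalgR g c →ₗ[k] k) : Prop where
  one : L 0 1 = 1
  gen_mul : ∀ n u, ∀ a ∈ degR g c n,
    L (n + 1) (gen g c u * a) = (u : Module.Dual k (Fin (t + 1) → k)) (y n) * L n a

namespace IsCharacter

variable {y : ℕ → Fin (t + 1) → k} {L : ℕ → subalgR g c →ₗ[k] k}

/-- The graded left ideal of `R` whose part of degree `n` is the kernel of `L n` on `R_n`. -/
noncomputable def ideal (h : IsCharacter y L) : Ideal (subalgR g c) where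
  carrier := {a | ∀ n, L n (DirectSum.decompose (degR g c) a n) = 0}
  add_mem' ha hb n := by
    rw [DirectSum.decompose_add, DirectSum.add_apply, Submodule.coe_add, map_add, ha n, hb n,
      add_zero]
  zero_mem' n := by simp
  smul_mem' b a ha := by
    have hadd : ∀ x y : subalgR g c,
        (∀ n, L n (DirectSum.decompose (degR g c) x n) = 0) →
        (∀ n, L n (DirectSum.decompose (degR g c) y n) = 0) →
        ∀ n, L n (DirectSum.decompose (degR g c) (x + y) n) = 0 := by
      intro x y hx hy n
      rw [DirectSum.decompose_add, DirectSum.add_apply, Submodule.coe_add, map_add, hx n, hy n,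
        add_zero]
    have hhom : ∀ {n : ℕ} {b : subalgR g c}, b ∈ degR g c n →
        ∀ n, L n (DirectSum.decompose (degR g c) (b * a) n) = 0 := by
      intro n b hb
      refine degR_induction g c (P := fun _ b => ∀ n, L n
        (DirectSum.decompose (degR g c) (b * a) n) = 0) ?_ ?_ ?_ ?_ ?_ hb
      · intro _ n
        simp
      · intro _ b b' hb hb'
        rw [add_mul]
        exact hadd _ _ hb hb'
      · intro _ r b hb n
        rw [smul_mul_assoc, DirectSum.decompose_smul, DirectSum.smul_apply, Submodule.coe_smul,
          map_smul, hb n, smul_zero]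
      · rw [one_mul]
        exact ha
      · intro _ u b _ hb n
        rw [mul_assoc]
        rcases n with - | n
        · rw [DirectSum.coe_decompose_mul_of_left_mem_of_not_le _ (gen_mem g c u) (by omega),
            map_zero]
        · rw [DirectSum.coe_decompose_mul_of_left_mem_of_le _ (gen_mem g c u) (by omega),
            Nat.add_sub_cancel, h.gen_mul _ _ _ (SetLike.coe_mem _), hb n, mul_zero]
    classical
    rw [smul_eq_mul, ← DirectSum.sum_support_decompose (degR g c) b, Finset.sum_mul]
    refine Finset.sum_induction _
      (fun x => ∀ n, L n (DirectSum.decompose (degR g c) x n) = 0) hadd (fun n => by simp) ?_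
    intro n _
    exact hhom (SetLike.coe_mem _)

theorem mem_ideal_iff (h : IsCharacter y L) {a : subalgR g c} : a ∈ h.ideal ↔
    ∀ n, L n (DirectSum.decompose (degR g c) a n) = 0 := Iff.rfl

theorem mem_ideal_iff_of_mem (h : IsCharacter y L) {n : ℕ} {a : subalgR g c}
    (ha : a ∈ degR g c n) : a ∈ h.ideal ↔ L n a = 0 := by
  rw [h.mem_ideal_iff]
  constructor
  · intro h1
    have := h1 n
    rwa [DirectSum.decompose_of_mem_same _ ha] at this
  · intro h1 j
    by_cases hj : n = j
    · subst hj
      rwa [DirectSum.decompose_of_mem_same _ ha]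
    · rw [DirectSum.decompose_of_mem_ne _ ha hj, map_zero]

theorem ideal_graded (h : IsCharacter y L) : h.ideal.restrictScalars k ≤
    ⨆ n, h.ideal.restrictScalars k ⊓ (GrMod.regular (degR g c)).deg n := by
  classical
  intro a ha
  rw [← DirectSum.sum_support_decompose (degR g c) a]
  refine Submodule.sum_mem _ fun n _ => Submodule.mem_iSup_of_mem (Int.ofNat n) ⟨?_, ?_⟩
  · exact (h.mem_ideal_iff_of_mem (SetLike.coe_mem _)).2 (ha n)
  · exact SetLike.coe_mem (DirectSum.decompose (degR g c) a n)

/-- The quotient of `R` by the left ideal of a character. -/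
noncomputable def module (h : IsCharacter y L) : GrMod.{u, u, u} (degR g c) :=
  (GrMod.regular (degR g c)).quot h.ideal h.ideal_graded

theorem apply_word (h : IsCharacter y L) (u : ℕ → formsAt c) (n : ℕ) :
    L n (word g c u n) =
      ∏ j ∈ Finset.range n, (u j : Module.Dual k (Fin (t + 1) → k)) (y j) := by
  induction n with
  | zero => exact h.one
  | succ n ih =>
    rw [word, h.gen_mul _ _ _ (word_mem g c u n), ih, Finset.prod_range_succ, mul_comm]

theorem exists_isString (h : IsCharacter y L) (hy : ∀ n, y n ∉ Submodule.span k {c.rep}) :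
    ∃ m : ℕ → h.module.carrier, IsString h.module 0 y m ∧ h.module.pointIdeal = h.ideal := by
  obtain ⟨u, hu⟩ := exists_formsAt c y
  have h1 : ∀ n, L n (word g c u n) = 1 := fun n => by
    rw [h.apply_word, Finset.prod_eq_one fun j _ => hu j (hy j)]
  have hmk : ∀ {n : ℕ} {a b : subalgR g c}, a ∈ degR g c n → b ∈ degR g c n →
      L n a = L n b → h.ideal.mkQ a = h.ideal.mkQ b := by
    intro n a b ha hb he
    refine (Submodule.Quotient.eq h.ideal).2 ?_
    rw [h.mem_ideal_iff_of_mem (Submodule.sub_mem _ ha hb), map_sub, he, sub_self]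
  have hstr : IsString h.module 0 y fun n => h.ideal.mkQ (word g c u n) := by
    refine ⟨?_, ?_, ?_, ?_⟩
    · intro n h0
      have h2 : word g c u n ∈ h.ideal := (Submodule.Quotient.mk_eq_zero h.ideal).1 h0
      rw [h.mem_ideal_iff_of_mem (word_mem g c u n), h1] at h2
      exact one_ne_zero h2
    · intro n
      rw [zero_add]
      change Submodule.map (h.ideal.mkQ.restrictScalars k) (degR g c n) =
        Submodule.span k {h.ideal.mkQ (word g c u n)}
      apply le_antisymm
      · rintro _ ⟨a, ha, rfl⟩
        refine Submodule.mem_span_singleton.2 ⟨L n a, ?_⟩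
        refine Eq.trans (?_ : _ = h.ideal.mkQ (L n a • word g c u n)) (hmk (n := n)
          (Submodule.smul_mem _ _ (word_mem g c u n)) ha ?_)
        · rfl
        · rw [map_smul, h1, smul_eq_mul, mul_one]
      · rw [Submodule.span_singleton_le_iff_mem]
        exact ⟨word g c u n, word_mem g c u n, rfl⟩
    · intro j hj
      obtain ⟨n, rfl⟩ := Int.eq_negSucc_of_lt_zero hj
      exact Submodule.map_bot (h.ideal.mkQ.restrictScalars k)
    · intro n v
      refine hmk (n := n + 1) (a := gen g c v * word g c u n)
        (b := (v : Module.Dual k (Fin (t + 1) → k)) (y n) • word g c u (n + 1))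
        (gen_mul_mem g c v (word_mem g c u n))
        (Submodule.smul_mem _ _ (word_mem g c u (n + 1))) ?_
      rw [h.gen_mul _ _ _ (word_mem g c u n), map_smul, h1, h1, smul_eq_mul]
  refine ⟨_, hstr, ?_⟩
  ext a
  rw [hstr.mem_pointIdeal_iff]
  change h.ideal.mkQ (a * 1) = 0 ↔ _
  rw [mul_one]
  exact Submodule.Quotient.mk_eq_zero h.ideal

end IsCharacter

end Characters

/-! ### The modules `P(c_i, e)` -/

section Tangent

variable {k : Type u} [Field k] {t : ℕ} {g : (Fin (t + 1) → k) ≃ₗ[k] (Fin (t + 1) → k)}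
  {c : Projectivization k (Fin (t + 1) → k)}

/-- The vectors of the string `P(c_i, e)`, moved to `c` by `φ^n`, where `x` is a tangent direction
at `c_i`: all lines but the `i`-th one pass through `c_i`, and the `i`-th one has the direction `x`.
-/
noncomputable def tangentVec (g : (Fin (t + 1) → k) ≃ₗ[k] (Fin (t + 1) → k))
    (c : Projectivization k (Fin (t + 1) → k)) (i : ℕ) (x : Fin (t + 1) → k) (n : ℕ) :
    Fin (t + 1) → k :=
  (g ^ n) (if n = i then x else (orbitPt g c i).rep)

/-- The functionals whose kernels form the point ideal of `P(c_i, e)`. Elements of `R_n` are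
evaluated at `c_i` for `n ≤ i`. For `n > i` they vanish at `c_i`, and their derivative at `c_i` in
the direction `x` is taken instead. -/
noncomputable def tangentFunctional (g : (Fin (t + 1) → k) ≃ₗ[k] (Fin (t + 1) → k))
    (c : Projectivization k (Fin (t + 1) → k)) (i : ℕ) (x : Fin (t + 1) → k) (n : ℕ) :
    subalgR g c →ₗ[k] k :=
  (if n ≤ i then (aeval (orbitPt g c i).rep).toLinearMap else dirDeriv (orbitPt g c i).rep x) ∘ₗ
    (toPoly g).toLinearMap ∘ₗ (subalgR g c).val.toLinearMap

theorem tangentFunctional_of_le {i n : ℕ} (h : n ≤ i) (x : Fin (t + 1) → k) (a : subalgR g c) :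
    tangentFunctional g c i x n a = eval (orbitPt g c i).rep (toPoly g (a : ZhangTwist g)) := by
  rw [tangentFunctional, if_pos h, ← aeval_eq_eval]
  rfl

theorem tangentFunctional_of_lt {i n : ℕ} (h : i < n) (x : Fin (t + 1) → k) (a : subalgR g c) :
    tangentFunctional g c i x n a =
      dirDeriv (orbitPt g c i).rep x (toPoly g (a : ZhangTwist g)) := by
  rw [tangentFunctional, if_neg (by omega)]
  rfl

theorem orbitPt_rep_mem_span (g : (Fin (t + 1) → k) ≃ₗ[k] (Fin (t + 1) → k))
    (c : Projectivization k (Fin (t + 1) → k)) (i : ℤ) :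
    (orbitPt g c i).rep ∈ Submodule.span k {orbitVec g c i} :=
  (eq_orbitPt_iff g c _ i).1 rfl

theorem isCharacter_tangentFunctional (g : (Fin (t + 1) → k) ≃ₗ[k] (Fin (t + 1) → k))
    (c : Projectivization k (Fin (t + 1) → k)) (i : ℕ) (x : Fin (t + 1) → k) :
    IsCharacter (tangentVec g c i x) (tangentFunctional g c i x) where
  one := by
    rw [tangentFunctional_of_le (Nat.zero_le i)]
    exact map_one (eval (orbitPt g c i).rep)
  gen_mul n u a ha := by
    have hvan : ∀ n, i < n → ∀ a : subalgR g c, a ∈ degR g c n →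
        eval (orbitPt g c i).rep (toPoly g (a : ZhangTwist g)) = 0 := fun n hn a ha =>
      eval_eq_zero_of_mem_degR g c ha i hn _ (orbitPt_rep_mem_span g c i)
    rcases lt_trichotomy n i with hn | rfl | hn
    · rw [tangentFunctional_of_le hn, tangentFunctional_of_le hn.le, toPoly_gen_mul g c u ha,
        map_mul, eval_linForm, tangentVec, if_neg hn.ne]
      rfl
    · have h0 : ((u : Module.Dual k (Fin (t + 1) → k)) ∘ₗ (g ^ n).toLinearMap)
          (orbitPt g c n).rep = 0 :=
        formsAt_apply_eq_zero u ((pow_mem_span_rep_iff g c n _).2 (orbitPt_rep_mem_span g c n))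
      rw [tangentFunctional_of_lt (Nat.lt_succ_self n), tangentFunctional_of_le le_rfl,
        toPoly_gen_mul g c u ha, dirDeriv_mul, eval_linForm, h0, dirDeriv_linForm, zero_mul,
        zero_add, tangentVec, if_pos rfl]
      rfl
    · rw [tangentFunctional_of_lt (by omega), tangentFunctional_of_lt hn,
        toPoly_gen_mul g c u ha, dirDeriv_mul, hvan n hn a ha, mul_zero, add_zero, eval_linForm,
        tangentVec, if_neg hn.ne']
      rfl

/-- The module `P(c_i, e)`, where `x` is a vector whose image in the tangent space at `c_i`
represents `e`. -/
noncomputable def tangentModule (g : (Fin (t + 1) → k) ≃ₗ[k] (Fin (t + 1) → k))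
    (c : Projectivization k (Fin (t + 1) → k)) (i : ℕ) (x : Fin (t + 1) → k) :
    GrMod.{u, u, u} (degR g c) :=
  (isCharacter_tangentFunctional g c i x).module

theorem tangentVec_notMem (hcrit : IsCriticallyDense (Set.range (orbitPt g c))) {i : ℕ}
    {x : Fin (t + 1) → k} (hx : x ∉ Submodule.span k {(orbitPt g c i).rep}) (n : ℕ) :
    tangentVec g c i x n ∉ Submodule.span k {c.rep} := by
  rw [tangentVec, pow_mem_span_rep_iff]
  split_ifs with h
  · rwa [h, ← span_orbitPt_rep]
  · rw [← eq_orbitPt_iff]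
    intro he
    exact h (by exact_mod_cast (orbitPt_injective hcrit.1 he).symm)

theorem exists_isString_tangentModule (hcrit : IsCriticallyDense (Set.range (orbitPt g c)))
    {i : ℕ} {x : Fin (t + 1) → k} (hx : x ∉ Submodule.span k {(orbitPt g c i).rep}) :
    ∃ m : ℕ → (tangentModule g c i x).carrier,
      IsString (tangentModule g c i x) 0 (tangentVec g c i x) m ∧
      (tangentModule g c i x).pointIdeal = (isCharacter_tangentFunctional g c i x).ideal :=
  (isCharacter_tangentFunctional g c i x).exists_isString (tangentVec_notMem hcrit hx)

theorem pow_rep_notMem {d : Projectivization k (Fin (t + 1) → k)}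
    (hd : ∀ i : ℕ, d ≠ orbitPt g c i) (n : ℕ) :
    (g ^ n) d.rep ∉ Submodule.span k {c.rep} := by
  rw [pow_mem_span_rep_iff, ← eq_orbitPt_iff]
  exact hd n

theorem pow_orbitPt_rep_notMem (hcrit : IsCriticallyDense (Set.range (orbitPt g c))) {i n : ℕ}
    (hn : n ≠ i) : (g ^ n) (orbitPt g c i).rep ∉ Submodule.span k {c.rep} := by
  rw [pow_mem_span_rep_iff, ← eq_orbitPt_iff]
  intro he
  exact hn (by exact_mod_cast (orbitPt_injective hcrit.1 he).symm)

/-- Beyond degree `i` both modules are strings with the vectors `φ^n(c_i)`, which for `n > i` are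
not multiples of `c`. -/
theorem tangentModule_tail_isom (hcrit : IsCriticallyDense (Set.range (orbitPt g c)))
    {i : ℕ} {x : Fin (t + 1) → k} (hx : x ∉ Submodule.span k {(orbitPt g c i).rep}) :
    ((tangentModule g c i x).tail (i + 1)).Isom
      ((pointModuleR g c (orbitPt g c i)).tail (i + 1)) := by
  obtain ⟨m, hm, -⟩ := exists_isString_tangentModule hcrit hx
  obtain ⟨m', hm', -⟩ := exists_isString_pointModuleR (g := g) (c := c) (orbitPt g c i)
  have hs : ((i : ℤ) + 1) = 0 + ((i + 1 : ℕ) : ℤ) := by push_cast; ring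
  have he : ∀ n, tangentVec g c i x (i + 1 + n) = (g ^ (i + 1 + n)) (orbitPt g c i).rep := by
    intro n
    rw [tangentVec, if_neg (by omega)]
  refine (hm.tail (i + 1) hs).isom (hm'.tail (i + 1) hs) (fun n => tangentVec_notMem hcrit hx _)
    (fun n => pow_orbitPt_rep_notMem hcrit (by omega)) fun n => ?_
  rw [he]
  exact SameModulo.refl _ _

theorem tangentModule_trunc_isom (hcrit : IsCriticallyDense (Set.range (orbitPt g c)))
    {i : ℕ} {x : Fin (t + 1) → k} (hx : x ∉ Submodule.span k {(orbitPt g c i).rep}) :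
    ((tangentModule g c i x).trunc i).Isom ((pointModuleR g c (orbitPt g c i)).trunc i) := by
  obtain ⟨m, hm, -⟩ := exists_isString_tangentModule hcrit hx
  obtain ⟨m', hm', -⟩ := exists_isString_pointModuleR (g := g) (c := c) (orbitPt g c i)
  refine hm.trunc_isom hm' (fun n _ => tangentVec_notMem hcrit hx n) fun n hn => ?_
  rw [tangentVec, if_neg hn.ne]

/-! ### Point ideals that contain `R ∩ 𝔪²` -/

theorem toPoly_decompose (a : subalgR g c) (n : ℕ) :
    toPoly g ((DirectSum.decompose (degR g c) a n : subalgR g c) : ZhangTwist g) =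
      homogeneousComponent n (toPoly g (a : ZhangTwist g)) := by
  induction a using DirectSum.Decomposition.inductionOn (degR g c) with
  | zero => simp
  | @homogeneous j b =>
    have hb : (toPoly g ((b : subalgR g c) : ZhangTwist g)).IsHomogeneous j := b.2
    rw [homogeneousComponent_of_mem hb]
    by_cases hjn : j = n
    · subst hjn
      rw [DirectSum.decompose_of_mem_same _ b.2, if_pos rfl]
    · rw [DirectSum.decompose_of_mem_ne _ b.2 hjn, if_neg (Ne.symm hjn)]
      simp
  | add a b iha ihb =>
    rw [DirectSum.decompose_add, DirectSum.add_apply]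
    simp only [Submodule.coe_add, Subalgebra.coe_add, map_add, iha, ihb]

/-- The point ideal of `P(c_i, e)` contains `R ∩ 𝔪²`, since polynomials in `𝔪²` vanish at `c_i`
together with their derivatives. -/
theorem interSqIdeal_le_ideal (i : ℕ) (x : Fin (t + 1) → k) :
    interSqIdeal g c (orbitPt g c i) ≤ (isCharacter_tangentFunctional g c i x).ideal := by
  intro a ha n
  have h1 : homogeneousComponent n (toPoly g (a : ZhangTwist g)) ∈
      vanishingIdeal (orbitPt g c i) ^ 2 := vanishingIdeal_sq_isHomogeneous _ _ ha n
  rw [← toPoly_decompose] at h1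
  rcases le_or_gt n i with hn | hn
  · rw [tangentFunctional_of_le hn]
    exact eval_eq_zero_of_mem_sq h1
  · rw [tangentFunctional_of_lt hn]
    exact dirDeriv_eq_zero_of_mem_sq x h1

theorem linForm_mem_vanishingIdeal {i : ℕ} {w : Module.Dual k (Fin (t + 1) → k)}
    (hw : w (orbitVec g c i) = 0) : linForm w ∈ vanishingIdeal (orbitPt g c i) := by
  obtain ⟨r, -, hr⟩ := exists_orbitPt_rep g c i
  rw [mem_vanishingIdeal_iff (linForm_isHomogeneous w), eval_linForm, hr, map_smul, hw, smul_zero]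

/-- If `R ∩ 𝔪²`, with `𝔪` the ideal of `c_i`, annihilates the generator of a string, then all lines
but the `i`-th one pass through `c_i`. -/
theorem IsString.mem_span_pair_of_interSqIdeal_le {M : GrMod.{u, v, u} (degR g c)}
    {y : ℕ → Fin (t + 1) → k} {m : ℕ → M.carrier} (h : IsString M 0 y m)
    (hy : ∀ n, y n ∉ Submodule.span k {c.rep}) {i : ℕ}
    (hle : interSqIdeal g c (orbitPt g c i) ≤ M.pointIdeal) {j : ℕ} (hj : j ≠ i) :
    (g ^ j).symm (y j) ∈ Submodule.span k {orbitVec g c i, orbitVec g c j} := by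
  refine mem_span_pair_of_dual fun v hvi hvj => ?_
  obtain ⟨w₀, hw₀, hw₀'⟩ := exists_dual_family (g := g) (c := c)
    (x := fun n => (g ^ n).symm (y n)) fun n => by
      rw [symm_pow_mem_span_iff]
      exact hy n
  let W : ℕ → Module.Dual k (Fin (t + 1) → k) := Function.update w₀ j v
  have hWj : W j = v := Function.update_self _ _ _
  have hWn : ∀ n, n ≠ j → W n = w₀ n := fun n hn => Function.update_of_ne hn _ _
  have hW : ∀ n : ℕ, W n (orbitVec g c n) = 0 := by
    intro n
    by_cases hn : n = j
    · subst hn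
      rw [hWj, hvj]
    · rw [hWn n hn, hw₀]
  obtain ⟨u, hu, hword⟩ := exists_formsAt_comp hW
  -- the product has the two factors `W i` and `W j` that vanish at `c_i`, so it lies in `𝔪²`
  have hmem : word g c u (i + j + 1) ∈ interSqIdeal g c (orbitPt g c i) := by
    change toPoly g (word g c u (i + j + 1) : ZhangTwist g) ∈ vanishingIdeal (orbitPt g c i) ^ 2
    have hdvd : linForm (W i) * linForm (W j) ∣
        ∏ n ∈ Finset.range (i + j + 1), linForm (W n) := by
      rw [← Finset.prod_pair (f := fun n => linForm (W n)) hj.symm]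
      refine Finset.prod_dvd_prod_of_subset _ _ _ fun n hn => ?_
      rcases Finset.mem_insert.1 hn with rfl | hn
      · exact Finset.mem_range.2 (by omega)
      · rw [Finset.mem_singleton.1 hn]
        exact Finset.mem_range.2 (by omega)
    rw [hword]
    refine Ideal.mem_of_dvd _ hdvd ?_
    rw [pow_two]
    exact Ideal.mul_mem_mul (linForm_mem_vanishingIdeal (hW i))
      (linForm_mem_vanishingIdeal (by rw [hWj, hvi]))
  have h1 := (h.mem_pointIdeal_iff _).1 (hle hmem)
  rw [h.word_smul, smul_eq_zero_iff_left (h.ne_zero _), Finset.prod_eq_single j] at h1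
  · rwa [hu, hWj] at h1
  · intro n _ hn
    rw [hu, hWn n hn, hw₀']
  · intro hn
    exact (hn (Finset.mem_range.2 (by omega))).elim

/-! ### Isomorphism classes in terms of lines through the orbit -/

/-- A comparison of strings after moving the lines through `c` back to the points `c_n`. -/
theorem IsString.isom_of_orbit {M : GrMod.{u, v, u} (degR g c)} {N : GrMod.{u, v', u} (degR g c)}
    {y : ℕ → Fin (t + 1) → k} {x : ℕ → Fin (t + 1) → k} {m : ℕ → M.carrier} {m' : ℕ → N.carrier}
    (h : IsString M 0 y m) (h' : IsString N 0 (fun n => (g ^ n) (x n)) m')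
    (hy : ∀ n, y n ∉ Submodule.span k {c.rep})
    (hyy : ∀ n : ℕ, SameModulo (K := k) (orbitVec g c n) ((g ^ n).symm (y n)) (x n)) :
    M.Isom N := by
  have h1 : ∀ n, SameModulo (K := k) c.rep (y n) ((g ^ n) (x n)) := by
    intro n
    have := (hyy n).map (g ^ n).toLinearMap
    simpa [pow_orbitVec_self] using this
  refine h.isom h' hy (fun n hn => hy n ?_) fun n => (h1 n).symm
  have h2 := (h1 n).mem_span_pair
  obtain ⟨r, hr⟩ := Submodule.mem_span_singleton.1 hn
  obtain ⟨a, b, hab⟩ := Submodule.mem_span_pair.1 h2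
  exact Submodule.mem_span_singleton.2 ⟨a * r + b, by rw [← hab, ← hr]; module⟩

theorem IsString.mem_span_pair_of_isom {M : GrMod.{u, v, u} (degR g c)}
    {N : GrMod.{u, v', u} (degR g c)} {x x' : ℕ → Fin (t + 1) → k} {m : ℕ → M.carrier}
    {m' : ℕ → N.carrier} (h : IsString M 0 (fun n => (g ^ n) (x n)) m)
    (h' : IsString N 0 (fun n => (g ^ n) (x' n)) m')
    (hy : ∀ n, (g ^ n) (x n) ∉ Submodule.span k {c.rep})
    (hy' : ∀ n, (g ^ n) (x' n) ∉ Submodule.span k {c.rep}) (hMN : M.Isom N) (n : ℕ) :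
    x' n ∈ Submodule.span k {x n, orbitVec g c n} := by
  have h1 := (h.sameModulo_of_isom h' hy hy' hMN n).map (g ^ n).symm.toLinearMap
  have h2 : SameModulo (K := k) (orbitVec g c n) (x' n) (x n) := by
    simpa [symm_pow_rep] using h1
  exact h2.mem_span_pair

/-- The only point on almost all lines through `p` and the points `c_n` is `p`. -/
theorem mem_span_of_eventually (ht : 2 ≤ t) (hcrit : IsCriticallyDense (Set.range (orbitPt g c)))
    {p q : Fin (t + 1) → k}
    (h : ∀ᶠ n : ℕ in Filter.cofinite, q ∈ Submodule.span k {p, orbitVec g c n}) :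
    q ∈ Submodule.span k {p} := by
  by_contra hq
  obtain ⟨n, h1, h2⟩ := (h.and (eventually_orbitVec_notMem ht hcrit p q)).exists
  exact notMem_span_pair_exchange h2 hq h1

theorem eq_of_rep_mem_span {n : ℕ} {d d' : Projectivization k (Fin n → k)}
    (h : d'.rep ∈ Submodule.span k {d.rep}) : d = d' := by
  rw [← d.mk_rep, ← d'.mk_rep, eq_comm, Projectivization.mk_eq_mk_iff']
  exact Submodule.mem_span_singleton.1 h

/-- Coordinates `π` on the quotient by a line `⟨p⟩`, that is on the tangent space of projective
space at `p`, with a linear section `β`. -/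
theorem exists_complement {n : ℕ} {p : Fin (n + 1) → k} (hp : p ≠ 0) :
    ∃ (π : (Fin (n + 1) → k) →ₗ[k] (Fin n → k)) (β : (Fin n → k) →ₗ[k] (Fin (n + 1) → k)),
      (∀ x, π x = 0 ↔ x ∈ Submodule.span k {p}) ∧ ∀ e, π (β e) = e := by
  have hfin : Module.finrank k ((Fin (n + 1) → k) ⧸ Submodule.span k {p}) =
      Module.finrank k (Fin n → k) := by
    have h1 := Submodule.finrank_quotient_add_finrank (Submodule.span k {p})
    rw [finrank_span_singleton hp, Module.finrank_fin_fun] at h1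
    rw [Module.finrank_fin_fun]
    omega
  let ε := LinearEquiv.ofFinrankEq _ _ hfin
  let π := ε.toLinearMap ∘ₗ (Submodule.span k {p}).mkQ
  have hsurj : Function.Surjective π := ε.surjective.comp (Submodule.mkQ_surjective _)
  obtain ⟨β, hβ⟩ := π.exists_rightInverse_of_surjective (LinearMap.range_eq_top.2 hsurj)
  refine ⟨π, β, fun x => ?_, fun e => LinearMap.congr_fun hβ e⟩
  change ε ((Submodule.span k {p}).mkQ x) = 0 ↔ _
  rw [LinearEquiv.map_eq_zero_iff, ← LinearMap.mem_ker, Submodule.ker_mkQ]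

/-- A string all of whose lines but the `i`-th one pass through `c_i` is one of the modules
`P(c_i, e)`. Here `π` and `β` identify the tangent directions at `c_i` with `k^t`. -/
theorem IsString.exists_isom_tangentModule (hcrit : IsCriticallyDense (Set.range (orbitPt g c)))
    {M : GrMod.{u, v, u} (degR g c)}
    {y : ℕ → Fin (t + 1) → k} {m : ℕ → M.carrier} (h : IsString M 0 y m)
    (hy : ∀ n, y n ∉ Submodule.span k {c.rep}) {i : ℕ}
    (hspan : ∀ j ≠ i, (g ^ j).symm (y j) ∈ Submodule.span k {orbitVec g c i, orbitVec g c j})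
    {π : (Fin (t + 1) → k) →ₗ[k] (Fin t → k)} {β : (Fin t → k) →ₗ[k] (Fin (t + 1) → k)}
    (hπ : ∀ x, π x = 0 ↔ x ∈ Submodule.span k {(orbitPt g c i).rep}) (hβ : ∀ e, π (β e) = e) :
    ∃ e : Projectivization k (Fin t → k), M.Isom (tangentModule g c i (β e.rep)) := by
  have hx : ∀ j : ℕ, (g ^ j).symm (y j) ∉ Submodule.span k {orbitVec g c j} := fun j => by
    rw [symm_pow_mem_span_iff]
    exact hy j
  have he : π ((g ^ i).symm (y i)) ≠ 0 := by
    rw [Ne, hπ, span_orbitPt_rep]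
    exact hx i
  let e := Projectivization.mk k _ he
  obtain ⟨s, hs⟩ := Projectivization.exists_smul_eq_mk_rep k _ he
  have hβe : β e.rep ∉ Submodule.span k {(orbitPt g c i).rep} := by
    rw [← hπ, hβ]
    exact e.rep_nonzero
  obtain ⟨m', hm', -⟩ := exists_isString_tangentModule hcrit hβe
  refine ⟨e, h.isom_of_orbit hm' hy fun j => ?_⟩
  by_cases hj : j = i
  · subst hj
    rw [if_pos rfl]
    refine (SameModulo.of_span_eq (span_orbitPt_rep g c j) ?_).symm
    refine ⟨s, s.ne_zero, (hπ _).1 ?_⟩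
    rw [map_sub, hβ, map_smul, sub_eq_zero]
    exact hs.symm
  · rw [if_neg hj]
    refine (sameModulo_of_mem_span_pair (hspan j hj) (hx j)).trans ?_
    obtain ⟨r, hr, hr'⟩ := exists_orbitPt_rep g c i
    exact (SameModulo.of_smul hr hr').symm

end Tangent

section Classification

variable {k : Type u} [Field k] {t : ℕ} {g : (Fin (t + 1) → k) ≃ₗ[k] (Fin (t + 1) → k)}
  {c : Projectivization k (Fin (t + 1) → k)}

/-! ### The hyperplane of `R_{i+1}` given by a tangent direction -/

theorem dirDeriv_map_eq_sum {n : ℕ} (p : Fin (t + 1) → k)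
    (β : (Fin n → k) →ₗ[k] (Fin (t + 1) → k)) (e : Fin n → k)
    (f : MvPolynomial (Fin (t + 1)) k) :
    dirDeriv p (β e) f = ∑ j, e j * dirDeriv p (β (Pi.single j 1)) f := by
  let D : Module.Dual k (Fin (t + 1) → k) :=
    { toFun := fun x => dirDeriv p x f
      map_add' := fun x y => dirDeriv_add_direction p x y f
      map_smul' := fun r x => dirDeriv_smul_direction p r x f }
  refine (dual_apply_eq_sum (D ∘ₗ β) e).trans (Finset.sum_congr rfl fun j _ => ?_)
  exact mul_comm _ _

/-- The derivatives of elements of `R_{i+1}` at `c_i` in the coordinate directions of the tangent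
space. -/
noncomputable def gradient (g : (Fin (t + 1) → k) ≃ₗ[k] (Fin (t + 1) → k))
    (c : Projectivization k (Fin (t + 1) → k)) (i : ℕ)
    (β : (Fin t → k) →ₗ[k] (Fin (t + 1) → k)) : degR g c (i + 1) →ₗ[k] (Fin t → k) :=
  LinearMap.pi fun j => dirDeriv (orbitPt g c i).rep (β (Pi.single j 1)) ∘ₗ
    (toPoly g).toLinearMap ∘ₗ (subalgR g c).val.toLinearMap ∘ₗ (degR g c (i + 1)).subtype

theorem gradient_apply (i : ℕ) (β : (Fin t → k) →ₗ[k] (Fin (t + 1) → k))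
    (f : degR g c (i + 1)) (j : Fin t) : gradient g c i β f j =
      dirDeriv (orbitPt g c i).rep (β (Pi.single j 1))
        (toPoly g ((f : subalgR g c) : ZhangTwist g)) := rfl

theorem sum_mul_gradient (i : ℕ) (β : (Fin t → k) →ₗ[k] (Fin (t + 1) → k))
    (f : degR g c (i + 1)) (e : Fin t → k) : ∑ j, e j * gradient g c i β f j =
      dirDeriv (orbitPt g c i).rep (β e) (toPoly g ((f : subalgR g c) : ZhangTwist g)) := by
  rw [dirDeriv_map_eq_sum]
  rfl

variable {i : ℕ} {π : (Fin (t + 1) → k) →ₗ[k] (Fin t → k)}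
  {β : (Fin t → k) →ₗ[k] (Fin (t + 1) → k)}

theorem gradient_eq_zero_iff (hπ : ∀ x, π x = 0 ↔ x ∈ Submodule.span k {(orbitPt g c i).rep})
    (hβ : ∀ e, π (β e) = e) (f : degR g c (i + 1)) :
    gradient g c i β f = 0 ↔ (f : subalgR g c) ∈ interSqIdeal g c (orbitPt g c i) := by
  set F := toPoly g ((f : subalgR g c) : ZhangTwist g) with hF
  have hhom : F.IsHomogeneous (i + 1) := f.2
  have h0 : eval (orbitPt g c i).rep F = 0 :=
    eval_eq_zero_of_mem_degR g c f.2 i (Nat.lt_succ_self i) _ (orbitPt_rep_mem_span g c i)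
  constructor
  · intro h
    refine mem_sq_of_dirDeriv_eq_zero hhom h0 fun x => ?_
    -- modulo `c_i`, where Euler's identity applies, every direction lies in the range of `β`
    have hx : x - β (π x) ∈ Submodule.span k {(orbitPt g c i).rep} := by
      rw [← hπ, map_sub, hβ, sub_self]
    obtain ⟨r, hr⟩ := Submodule.mem_span_singleton.1 hx
    have hx' : x = β (π x) + r • (orbitPt g c i).rep := by rw [hr]; module
    have h1 : dirDeriv (orbitPt g c i).rep (β (π x)) F = 0 := by
      rw [hF, ← sum_mul_gradient, h]
      simp
    have h2 : dirDeriv (orbitPt g c i).rep (orbitPt g c i).rep F = 0 := by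
      rw [dirDeriv_self _ hhom, h0, mul_zero]
    change dirDeriv (orbitPt g c i).rep x F = 0
    rw [hx', dirDeriv_add_direction, dirDeriv_smul_direction, h1, h2, mul_zero, add_zero]
  · intro h
    ext j
    exact dirDeriv_eq_zero_of_mem_sq _ h

/-- The surjectivity is seen on products of linear forms, the `i`-th of which is any linear form
that vanishes at `c_i`, while the others take the value `1` there. -/
theorem gradient_surjective (hcrit : IsCriticallyDense (Set.range (orbitPt g c)))
    (hπ : ∀ x, π x = 0 ↔ x ∈ Submodule.span k {(orbitPt g c i).rep})
    (hβ : ∀ e, π (β e) = e) : Function.Surjective (gradient g c i β) := by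
  intro τ
  let e₀ : Module.Dual k (Fin t → k) := ∑ j, τ j • LinearMap.proj j
  have hp : (orbitPt g c i).rep ≠ 0 := (orbitPt g c i).rep_nonzero
  have hw : ∀ n : ℕ, n ≠ i → ∃ w : Module.Dual k (Fin (t + 1) → k),
      w (orbitVec g c n) = 0 ∧ w (orbitPt g c i).rep = 1 := by
    intro n hn
    refine exists_dual_single ?_
    rw [← eq_orbitPt_iff]
    intro he
    exact hn (by exact_mod_cast (orbitPt_injective hcrit.1 he).symm)
  have hW : ∀ n : ℕ, ∃ w : Module.Dual k (Fin (t + 1) → k), w (orbitVec g c n) = 0 ∧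
      (n = i → w = e₀ ∘ₗ π) ∧ (n ≠ i → w (orbitPt g c i).rep = 1) := by
    intro n
    by_cases hn : n = i
    · subst hn
      refine ⟨e₀ ∘ₗ π, ?_, fun _ => rfl, fun h => (h rfl).elim⟩
      have : π (orbitVec g c n) = 0 := by
        rw [hπ, span_orbitPt_rep]
        exact Submodule.mem_span_singleton_self _
      rw [LinearMap.comp_apply, this, map_zero]
    · obtain ⟨w, h1, h2⟩ := hw n hn
      exact ⟨w, h1, fun h => (hn h).elim, fun _ => h2⟩
  choose W hW0 hWi hWn using hW
  obtain ⟨u, -, hword⟩ := exists_formsAt_comp hW0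
  refine ⟨⟨word g c u (i + 1), word_mem g c u (i + 1)⟩, ?_⟩
  ext j
  have hπp : π (orbitPt g c i).rep = 0 := (hπ _).2 (Submodule.mem_span_singleton_self _)
  have h1 : ∏ n ∈ Finset.range i, W n (orbitPt g c i).rep = 1 :=
    Finset.prod_eq_one fun n hn => hWn n (Finset.mem_range.1 hn).ne
  rw [gradient_apply, hword, Finset.prod_range_succ, dirDeriv_mul, map_prod]
  simp only [eval_linForm, dirDeriv_linForm]
  rw [h1, hWi i rfl, LinearMap.comp_apply, LinearMap.comp_apply, hπp, hβ, map_zero, mul_zero,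
    add_zero, one_mul]
  simp [e₀, Pi.single_apply]

/-! ### Separation and classification -/

theorem pointModuleR_isPointModule {d : Projectivization k (Fin (t + 1) → k)}
    (hd : ∀ i : ℕ, d ≠ orbitPt g c i) : (pointModuleR g c d).IsPointModule ∧
      (pointModuleR g c d).pointIdeal = interIdeal g c d := by
  obtain ⟨m, hm, hann⟩ := exists_isString_pointModuleR (g := g) (c := c) d
  refine ⟨hm.isPointModule (pow_rep_notMem hd), ?_⟩
  ext a
  rw [hm.mem_pointIdeal_iff, hann]

theorem shift_tail_isPointModule (hcrit : IsCriticallyDense (Set.range (orbitPt g c))) (i : ℕ) :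
    (((pointModuleR g c (orbitPt g c i)).tail (i + 1)).shift (i + 1)).IsPointModule := by
  obtain ⟨m, hm, -⟩ := exists_isString_pointModuleR (g := g) (c := c) (orbitPt g c i)
  have hs : ((i : ℤ) + 1) = 0 + ((i + 1 : ℕ) : ℤ) := by push_cast; ring
  exact (hm.tail (i + 1) hs).shift.isPointModule fun n => pow_orbitPt_rep_notMem hcrit (by omega)

theorem isPointModule_tangentModule (hcrit : IsCriticallyDense (Set.range (orbitPt g c))) {i : ℕ}
    {x : Fin (t + 1) → k} (hx : x ∉ Submodule.span k {(orbitPt g c i).rep}) :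
    (tangentModule g c i x).IsPointModule := by
  obtain ⟨m, hm, -⟩ := exists_isString_tangentModule hcrit hx
  exact hm.isPointModule (tangentVec_notMem hcrit hx)

theorem eq_of_pointModuleR_isom (ht : 2 ≤ t)
    (hcrit : IsCriticallyDense (Set.range (orbitPt g c)))
    {d d' : Projectivization k (Fin (t + 1) → k)} (hd : ∀ i : ℕ, d ≠ orbitPt g c i)
    (hd' : ∀ i : ℕ, d' ≠ orbitPt g c i)
    (h : (pointModuleR g c d).Isom (pointModuleR g c d')) : d = d' := by
  obtain ⟨m, hm, -⟩ := exists_isString_pointModuleR (g := g) (c := c) d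
  obtain ⟨m', hm', -⟩ := exists_isString_pointModuleR (g := g) (c := c) d'
  refine eq_of_rep_mem_span (mem_span_of_eventually ht hcrit (Filter.Eventually.of_forall ?_))
  exact hm.mem_span_pair_of_isom hm' (pow_rep_notMem hd) (pow_rep_notMem hd') h

theorem eventually_ne (i : ℕ) : ∀ᶠ n : ℕ in Filter.cofinite, n ≠ i :=
  (Set.finite_singleton i).subset fun _ hn => not_not.1 hn

theorem not_pointModuleR_isom_tangentModule (ht : 2 ≤ t)
    (hcrit : IsCriticallyDense (Set.range (orbitPt g c)))
    {d : Projectivization k (Fin (t + 1) → k)} (hd : ∀ i : ℕ, d ≠ orbitPt g c i) {i : ℕ}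
    {x : Fin (t + 1) → k} (hx : x ∉ Submodule.span k {(orbitPt g c i).rep}) :
    ¬ (pointModuleR g c d).Isom (tangentModule g c i x) := by
  intro h
  obtain ⟨m, hm, -⟩ := exists_isString_pointModuleR (g := g) (c := c) d
  obtain ⟨m', hm', -⟩ := exists_isString_tangentModule hcrit hx
  refine hd i (eq_of_rep_mem_span (mem_span_of_eventually ht hcrit ?_))
  filter_upwards [eventually_ne i] with n hn
  have := hm.mem_span_pair_of_isom hm' (pow_rep_notMem hd) (tangentVec_notMem hcrit hx) h n
  rwa [if_neg hn] at this

theorem eq_of_tangentModule_isom (ht : 2 ≤ t)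
    (hcrit : IsCriticallyDense (Set.range (orbitPt g c))) {i i' : ℕ} {x x' : Fin (t + 1) → k}
    (hx : x ∉ Submodule.span k {(orbitPt g c i).rep})
    (hx' : x' ∉ Submodule.span k {(orbitPt g c i').rep})
    (h : (tangentModule g c i x).Isom (tangentModule g c i' x')) :
    i = i' ∧ x' ∈ Submodule.span k {x, (orbitPt g c i).rep} := by
  obtain ⟨m, hm, -⟩ := exists_isString_tangentModule hcrit hx
  obtain ⟨m', hm', -⟩ := exists_isString_tangentModule hcrit hx'
  have key := hm.mem_span_pair_of_isom hm' (tangentVec_notMem hcrit hx)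
    (tangentVec_notMem hcrit hx') h
  have hi : i = i' := by
    have h1 : orbitPt g c i = orbitPt g c i' := by
      refine eq_of_rep_mem_span (mem_span_of_eventually ht hcrit ?_)
      filter_upwards [eventually_ne i, eventually_ne i'] with n hn hn'
      have := key n
      rwa [if_neg hn, if_neg hn'] at this
    exact_mod_cast orbitPt_injective hcrit.1 h1
  refine ⟨hi, ?_⟩
  subst hi
  have := key i
  rwa [if_pos rfl, if_pos rfl, Submodule.span_insert, ← span_orbitPt_rep,
    ← Submodule.span_insert] at this

/-- Either the lines of a point module have a common point `d` outside `{c_0, c_1, …}`, and the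
module is `P(d)`, or they meet in some `c_i`, and the module is one of the `P(c_i, e)`. -/
theorem IsString.isom_pointModuleR_or_span (ht : 2 ≤ t)
    (hcrit : IsCriticallyDense (Set.range (orbitPt g c))) {M : GrMod.{u, v, u} (degR g c)}
    {y : ℕ → Fin (t + 1) → k} {m : ℕ → M.carrier} (h : IsString M 0 y m)
    (hy : ∀ n, y n ∉ Submodule.span k {c.rep}) :
    (∃ d : Projectivization k (Fin (t + 1) → k), (∀ i : ℕ, d ≠ orbitPt g c i) ∧
      M.Isom (pointModuleR g c d)) ∨
    ∃ i : ℕ, ∀ j ≠ i,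
      (g ^ j).symm (y j) ∈ Submodule.span k {orbitVec g c i, orbitVec g c j} := by
  obtain ⟨p, hp, hcen⟩ := (h.compatibleLines hy).exists_center
    (fun i j hij => orbitVec_notMem_span hcrit i j (by exact_mod_cast hij))
    (eventually_orbitVec_notMem ht hcrit)
  by_cases hex : ∃ i : ℕ, p ∈ Submodule.span k {orbitVec g c i}
  · obtain ⟨i, hi⟩ := hex
    obtain ⟨r, rfl⟩ := Submodule.mem_span_singleton.1 hi
    have hr : r ≠ 0 := by
      rintro rfl
      exact hp (zero_smul _ _)
    refine Or.inr ⟨i, fun j hj => ?_⟩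
    have hpj : r • orbitVec g c i ∉ Submodule.span k {orbitVec g c j} := by
      rw [Submodule.smul_mem_iff _ hr]
      exact orbitVec_notMem_span hcrit i j (by exact_mod_cast hj.symm)
    exact ((hcen j hpj).trans (SameModulo.of_smul hr rfl)).mem_span_pair
  · push Not at hex
    obtain ⟨s, hs⟩ := Projectivization.exists_smul_eq_mk_rep k p hp
    have hd : ∀ i : ℕ, Projectivization.mk k p hp ≠ orbitPt g c i := by
      intro i
      rw [Ne, eq_orbitPt_iff, ← hs, Units.smul_def, Submodule.smul_mem_iff _ s.ne_zero]
      exact hex i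
    obtain ⟨m', hm', -⟩ :=
      exists_isString_pointModuleR (g := g) (c := c) (Projectivization.mk k p hp)
    exact Or.inl ⟨_, hd, h.isom_of_orbit hm' hy fun n => (hcen n (hex n)).trans
      (SameModulo.of_smul s.ne_zero hs.symm).symm⟩

end Classification

end PointModules

open PointModules
theorem mainTheorem8 {k : Type u} [Field k] [IsAlgClosed k] {t : ℕ} (ht : 2 ≤ t)
    (g : (Fin (t + 1) → k) ≃ₗ[k] (Fin (t + 1) → k))
    (c : Projectivization k (Fin (t + 1) → k))
    (hcrit : IsCriticallyDense (Set.range (orbitPt g c))) :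
    -- (1) the modules `P(d)`
    (∀ d : Projectivization k (Fin (t + 1) → k), (∀ i : ℕ, d ≠ orbitPt g c i) →
      (pointModuleR g c d).IsPointModule ∧
      (pointModuleR g c d).pointIdeal = interIdeal g c d) ∧
    -- (2) `P(c_i)_{≥ i+1}` is a shifted point module
    (∀ i : ℕ, (((pointModuleR g c (orbitPt g c i)).tail (i + 1)).shift (i + 1)).IsPointModule) ∧
    -- (2) the modules `P(c_i, e)`
    ∃ P : ℕ → Projectivization k (Fin t → k) → GrMod.{u, u} (degR g c),
      (∀ (i : ℕ) (e : Projectivization k (Fin t → k)),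
        (P i e).IsPointModule ∧
        ((P i e).tail (i + 1)).Isom ((pointModuleR g c (orbitPt g c i)).tail (i + 1)) ∧
        ((P i e).trunc i).Isom ((pointModuleR g c (orbitPt g c i)).trunc i)) ∧
      -- `e` is the hyperplane of `R_{i+1} / (R ∩ 𝔪²)_{i+1} ≅ k^t` that is given by the
      -- degree `i + 1` part of the point ideal
      (∀ i : ℕ, ∃ l : degR g c (i + 1) →ₗ[k] (Fin t → k),
        Function.Surjective l ∧
        (∀ f, l f = 0 ↔ (f : subalgR g c) ∈ interSqIdeal g c (orbitPt g c i)) ∧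
        ∀ (e : Projectivization k (Fin t → k)) (f : degR g c (i + 1)),
          (f : subalgR g c) ∈ (P i e).pointIdeal ↔ ∑ j, e.rep j * l f j = 0) ∧
      (∀ (i : ℕ) (M : GrMod.{u, v} (degR g c)), M.IsPointModule →
        (interSqIdeal g c (orbitPt g c i) ≤ M.pointIdeal ↔ ∃ e, M.Isom (P i e))) ∧
      -- (3) the modules in (1) and (2) are pairwise non-isomorphic
      (∀ d d' : Projectivization k (Fin (t + 1) → k), (∀ i : ℕ, d ≠ orbitPt g c i) →
        (∀ i : ℕ, d' ≠ orbitPt g c i) →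
        (pointModuleR g c d).Isom (pointModuleR g c d') → d = d') ∧
      (∀ d : Projectivization k (Fin (t + 1) → k), (∀ i : ℕ, d ≠ orbitPt g c i) →
        ∀ i e, ¬ (pointModuleR g c d).Isom (P i e)) ∧
      (∀ i e i' e', (P i e).Isom (P i' e') → i = i' ∧ e = e') ∧
      -- (3) every point module is one of these
      (∀ M : GrMod.{u, v} (degR g c), M.IsPointModule →
        (∃ d : Projectivization k (Fin (t + 1) → k), (∀ i : ℕ, d ≠ orbitPt g c i) ∧
          M.Isom (pointModuleR g c d)) ∨
        ∃ i e, M.Isom (P i e)) := by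
  choose π β hπ hβ using fun i : ℕ => exists_complement (orbitPt g c i).rep_nonzero
  have hx : ∀ (i : ℕ) (e : Projectivization k (Fin t → k)),
      β i e.rep ∉ Submodule.span k {(orbitPt g c i).rep} := by
    intro i e
    rw [← hπ, hβ]
    exact e.rep_nonzero
  refine ⟨fun d hd => pointModuleR_isPointModule hd, shift_tail_isPointModule hcrit,
    fun i e => tangentModule g c i (β i e.rep), fun i e => ⟨isPointModule_tangentModule hcrit
      (hx i e), tangentModule_tail_isom hcrit (hx i e), tangentModule_trunc_isom hcrit (hx i e)⟩,
    fun i => ⟨gradient g c i (β i), gradient_surjective hcrit (hπ i) (hβ i),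
      gradient_eq_zero_iff (hπ i) (hβ i), fun e f => ?_⟩, fun i M hM => ⟨fun hle => ?_, ?_⟩,
    fun d d' hd hd' h => eq_of_pointModuleR_isom ht hcrit hd hd' h,
    fun d hd i e => not_pointModuleR_isom_tangentModule ht hcrit hd (hx i e),
    fun i e i' e' h => ?_, fun M hM => ?_⟩
  · obtain ⟨m, -, hideal⟩ := exists_isString_tangentModule hcrit (hx i e)
    rw [hideal, IsCharacter.mem_ideal_iff_of_mem _ f.2,
      tangentFunctional_of_lt (Nat.lt_succ_self i), sum_mul_gradient]
  · obtain ⟨y, m, hm, hy⟩ := hM.exists_isString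
    exact hm.exists_isom_tangentModule hcrit hy
      (fun j hj => hm.mem_span_pair_of_interSqIdeal_le hy hle hj) (hπ i) (hβ i)
  · rintro ⟨e, he⟩
    obtain ⟨m, -, hideal⟩ := exists_isString_tangentModule hcrit (hx i e)
    rw [he.pointIdeal_eq, hideal]
    exact interSqIdeal_le_ideal i _
  · obtain ⟨rfl, h1⟩ := eq_of_tangentModule_isom ht hcrit (hx i e) (hx i' e') h
    refine ⟨rfl, eq_of_rep_mem_span ?_⟩
    obtain ⟨a, b, hab⟩ := Submodule.mem_span_pair.1 h1
    refine Submodule.mem_span_singleton.2 ⟨a, ?_⟩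
    have h2 := congrArg (π i) hab
    rwa [map_add, map_smul, map_smul, (hπ i _).2 (Submodule.mem_span_singleton_self _), smul_zero,
      add_zero, hβ, hβ] at h2
  · obtain ⟨y, m, hm, hy⟩ := hM.exists_isString
    rcases hm.isom_pointModuleR_or_span ht hcrit hy with h | ⟨i, hi⟩
    · exact Or.inl h
    · exact Or.inr ⟨i, hm.exists_isom_tangentModule hcrit hy hi (hπ i) (hβ i)⟩
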